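/- Let $p$ be a prime number. All graded vector spaces are $\mathbb N$-graded vector spaces over $\mathbb F_p$. Let $\mathcal P$ be a symmetric operad in $\mathbb F_p$-vector spaces, placed in degree $0$ when it acts on graded vector spaces. Let $\star\in\mathcal P(p)$ be an operation which is invariant under the symmetric group $\Sigma_p$ and $\mathcal P$-central, i.e. for all $n\ge 0$ and all $\mu\in\mathcal P(n)$, $$\star(\mu,\dots,\mu)=\mu(\star,\dots,\star)\cdot\sigma_{p,n},$$ where $\sigma_{p,n}\in\Sigma_{pn}$ sends $in+k$ to $(k-1)p+(i+1)$ for $0\le i<p$, $1\le k\le n$. A Frobenius map on a graded vector space $M$ is a family of linear maps $M^i\to M^{pi}$, $x\mapsto x^{[p]}$. Let $V$ be a graded vector space, and let $\operatorname{Fr}(V)=\bigoplus_{k\ge0}\{x^{[p^k]}: x\in V\}$, with $|x^{[p^k]}|=p^k|x|$, be the free graded vector space with Frobenius map generated by $V$. For a graded vector space $M$, let $S(\mathcal P,M)=\bigoplus_{n\ge0}\mathcal P(n)\otimes_{\Sigma_n}M^{\otimes n}$ be the free graded $\mathcal P$-algebra on $M$; if $M$ has a Frobenius map, so has $S(\mathcal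 P,M)$, by $\mu(x_1,\dots,x_n)^{[p]}=\mu(x_1^{[p]},\dots,x_n^{[p]})$. Let $$\mathcal A^\star_{\mathcal P}(M)=S(\mathcal P,M)\big/\big(\mathfrak t^{[p]}-\star(\mathfrak t,\dots,\mathfrak t)\,:\,\mathfrak t\in S(\mathcal P,M)\big)_{\mathcal P}$$ be the quotient by the $\mathcal P$-ideal generated by these elements; it is the free $\mathcal P$-algebra with $\star$-adapted Frobenius (i.e. with $x^{[p]}=\star(x,\dots,x)$ for all $x$) generated by $M$. Then there is an isomorphism of graded $\mathcal P$-algebras $$\mathcal A^\star_{\mathcal P}(\operatorname{Fr}(V))\cong S(\mathcal P,V).$$ This holds both for the symmetry $x\otimes y\mapsto y\otimes x$ of the tensor product of graded vector spaces, and for the symmetry $x\otimes y\mapsto(-1)^{|x||y|}y\otimes x$ with Koszul signs. -/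

import Mathlib

open scoped TensorProduct DirectSum

universe w u v

namespace OperadFrob

section Multilinear

variable {F : Type*} [Field F] {ι : Type*} [Fintype ι] [dι : DecidableEq ι] {M : ι → Type*}
  [∀ i, AddCommGroup (M i)] [∀ i, Module F (M i)] {N : Type*} [AddCommGroup N] [Module F N]

theorem multilinear_eq_zero (f : MultilinearMap F M N) (s : ∀ i, Set (M i))
    (h : ∀ x, (∀ i, x i ∈ s i) → f x = 0) (y : ∀ i, M i)
    (hy : ∀ i, y i ∈ Submodule.span F (s i)) : f y = 0 := by
  have key : ∀ T : Finset ι, ∀ y : ∀ i, M i, (∀ i ∈ T, y i ∈ Submodule.span F (s i)) →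
      (∀ i ∉ T, y i ∈ s i) → f y = 0 := by
    intro T
    induction T using Finset.induction_on with
    | empty => intro y _ h2; exact h y fun i => h2 i (by simp)
    | insert a T ha ih =>
      intro y h1 h2
      have h3 : ∀ z ∈ Submodule.span F (s a), f (Function.update y a z) = 0 := by
        intro z hz
        induction hz using Submodule.span_induction with
        | mem z hz =>
          apply ih
          · intro i hi
            have : i ≠ a := fun h => ha (h ▸ hi)
            simpa [this] using h1 i (by simp [hi])
          · intro i hi
            by_cases hia : i = a
            · subst hia; simpa using hz
            · simpa [hia] using h2 i (by simp [hi, hia])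
        | zero => exact f.map_update_zero y a
        | add z z' _ _ h1 h2 => rw [f.map_update_add, h1, h2, add_zero]
        | smul c z _ h1 => rw [f.map_update_smul, h1, smul_zero]
      have := h3 (y a) (h1 a (by simp))
      simpa using this
  exact key Finset.univ y (fun i _ => hy i) (by simp)

theorem multilinear_ext (f g : MultilinearMap F M N) (s : ∀ i, Set (M i))
    (hs : ∀ i, Submodule.span F (s i) = ⊤)
    (h : ∀ x, (∀ i, x i ∈ s i) → f x = g x) : f = g := by
  ext y
  rw [← sub_eq_zero]
  exact multilinear_eq_zero (f - g) s (fun x hx => by simp [h x hx]) y (by simp [hs])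

theorem multilinear_congr (f : MultilinearMap F M N) (K : ∀ i, Submodule F (M i))
    (h : ∀ i x, x i ∈ K i → f x = 0) (a b : ∀ i, M i) (hab : ∀ i, a i - b i ∈ K i) :
    f a = f b := by
  have key : ∀ T : Finset ι, f (T.piecewise a b) = f b := by
    intro T
    induction T using Finset.induction_on with
    | empty => simp
    | insert c T hc ih =>
      rw [Finset.piecewise_insert, ← ih]
      conv_rhs => rw [← Function.update_eq_self c (T.piecewise a b)]
      rw [← sub_eq_zero, ← f.map_update_sub]
      apply h c
      simpa [hc] using hab c
  simpa using key Finset.univ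

theorem exists_multilinear_of_surjective {M' : ι → Type*} [∀ i, AddCommGroup (M' i)]
    [∀ i, Module F (M' i)] (q : ∀ i, M i →ₗ[F] M' i) (hq : ∀ i, Function.Surjective (q i))
    (f : MultilinearMap F M N) (h : ∀ i x, q i (x i) = 0 → f x = 0) :
    ∃ G : MultilinearMap F M' N, ∀ x, G (fun i => q i (x i)) = f x := by
  have hc : ∀ a b : ∀ i, M i, (∀ i, q i (a i) = q i (b i)) → f a = f b := fun a b hab =>
    multilinear_congr f (fun i => LinearMap.ker (q i)) (fun i x hx => h i x hx) a b
      (fun i => by simp [hab i])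
  choose r hr using hq
  have hu : ∀ (i : ι) (m : ∀ i, M' i) (z : M' i) (z' : M i), q i z' = z →
      f (fun j => r j (Function.update m i z j)) =
        f (Function.update (fun j => r j (m j)) i z') := by
    intro i m z z' hz
    apply hc
    intro j
    by_cases hj : j = i
    · subst hj; simp [hr, hz]
    · simp [hj]
  refine ⟨{ toFun := fun m => f fun i => r i (m i), map_update_add' := ?_, map_update_smul' := ?_ },
    fun x => hc _ _ fun i => hr i _⟩
  · intro dec m i x y
    obtain rfl : dec = dι := Subsingleton.elim _ _
    rw [hu i m (x + y) (r i x + r i y) (by simp [hr]), hu i m x (r i x) (hr i x),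
      hu i m y (r i y) (hr i y), f.map_update_add]
  · intro dec m i c x
    obtain rfl : dec = dι := Subsingleton.elim _ _
    rw [hu i m (c • x) (c • r i x) (by simp [hr]), hu i m x (r i x) (hr i x),
      f.map_update_smul]

theorem exists_multilinear_of_generators {X : ι → Type*} (gen : ∀ i, X i → M i)
    (hgen : ∀ i, Submodule.span F (Set.range (gen i)) = ⊤) (g : (∀ i, X i) → N)
    (hg : ∀ (i : ι) (x : ∀ i, X i), ∃ L : M i →ₗ[F] N, ∀ y, L (gen i y) = g (Function.update x i y)) :
    ∃ G : MultilinearMap F M N, ∀ x, G (fun i => gen i (x i)) = g x := by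
  classical
  let H : MultilinearMap F (fun i => Π₀ _ : X i, F) N :=
    MultilinearMap.fromDFinsuppEquiv (κ := X) (R := F) (M := fun _ _ => F)
      (fun x => MultilinearMap.mkPiRing F ι (g x))
  have H1 : ∀ (x : ∀ i, X i) (c : ι → F), H (fun i => DFinsupp.single (x i) (c i)) = (∏ i, c i) • g x := by
    intro x c
    simp [H, MultilinearMap.fromDFinsuppEquiv_single]
  let q : ∀ i, (Π₀ _ : X i, F) →ₗ[F] M i := fun i =>
    DFinsupp.lsum F (fun x => LinearMap.toSpanSingleton F (M i) (gen i x))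
  have q1 : ∀ i (x : X i) (c : F), q i (DFinsupp.single x c) = c • gen i x := by
    intro i x c
    simp [q]
  have hq : ∀ i, Function.Surjective (q i) := by
    intro i
    rw [← LinearMap.range_eq_top, eq_top_iff, ← hgen i, Submodule.span_le]
    rintro _ ⟨x, rfl⟩
    exact ⟨DFinsupp.single x 1, by simp [q1]⟩
  have hspan : ∀ i, Submodule.span F (Set.range fun x : X i => (DFinsupp.single x (1 : F) : Π₀ _ : X i, F)) = ⊤ := by
    intro i
    rw [eq_top_iff]
    rintro z -
    induction z using DFinsupp.induction with
    | h0 => exact zero_mem _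
    | ha x c f _ _ hf =>
      refine add_mem ?_ hf
      have : (DFinsupp.single x c : Π₀ _ : X i, F) = c • DFinsupp.single x 1 := by
        rw [← DFinsupp.single_smul]; simp
      rw [this]
      exact Submodule.smul_mem _ _ (Submodule.subset_span ⟨x, rfl⟩)
  obtain ⟨G, hG⟩ := exists_multilinear_of_surjective q hq H (by
    intro i a ha
    refine multilinear_eq_zero H (fun j => if j = i then {a j} else
      Set.range fun x : X j => (DFinsupp.single x (1 : F) : Π₀ _ : X j, F)) ?_ a ?_
    · intro y hy
      have hyi : y i = a i := by simpa using hy i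
      by_cases hX : Nonempty (X i)
      · obtain ⟨x0⟩ := hX
        have : ∀ j, ∃ x : X j, j ≠ i → DFinsupp.single x 1 = y j := by
          intro j
          by_cases hj : j = i
          · subst hj; exact ⟨x0, fun h => absurd rfl h⟩
          · have := hy j
            simp only [hj, if_false] at this
            obtain ⟨x, hx⟩ := this
            exact ⟨x, fun _ => hx⟩
        choose x hx using this
        obtain ⟨L, hL⟩ := hg i x
        have e1 : (L ∘ₗ q i) = H.toLinearMap (fun j => DFinsupp.single (x j) 1) i := by
          refine DFinsupp.lhom_ext fun y c => ?_
          simp only [LinearMap.comp_apply, q1, map_smul, hL, MultilinearMap.toLinearMap_apply]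
          have : (Function.update (fun j => (DFinsupp.single (x j) 1 : Π₀ _ : X j, F)) i (DFinsupp.single y c))
            = fun j => DFinsupp.single (Function.update x i y j) (Function.update (fun _ => (1:F)) i c j) := by
            funext j
            by_cases hj : j = i
            · subst hj; simp
            · simp [hj]
          rw [this, H1]
          congr 1
          simp [Finset.prod_update_of_mem]
        have e2 : y = Function.update (fun j => DFinsupp.single (x j) 1) i (a i) := by
          funext j
          by_cases hj : j = i
          · subst hj; simp [hyi]
          · simp [hj, hx j hj]
        rw [e2, ← MultilinearMap.toLinearMap_apply, ← e1, LinearMap.comp_apply, ha, map_zero]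
      · refine H.map_coord_zero i ?_
        ext x
        exact absurd ⟨x⟩ hX
    · intro j
      by_cases hj : j = i
      · simp only [hj, if_true]
        exact Submodule.subset_span (by simp)
      · simp only [hj, if_false, hspan]
        trivial)
  refine ⟨G, fun x => ?_⟩
  have := hG (fun i => DFinsupp.single (x i) 1)
  rw [H1] at this
  simpa [q1] using this

end Multilinear

section Flatten

/-- The index set of a concatenation of blocks of sizes `n 0, ..., n (k - 1)` is ordered
lexicographically. -/
theorem finSigma_val {k : ℕ} {n : Fin k → ℕ} (i : Fin k) (a : Fin (n i)) :
    (finSigmaFinEquiv ⟨i, a⟩ : ℕ) = (∑ j : Fin k, if j < i then n j else 0) + a := by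
  rw [finSigmaFinEquiv_apply]
  congr 1
  rw [← Finset.sum_filter]
  refine Finset.sum_bij' (fun j _ => Fin.castLE i.2.le j) (fun j hj => ⟨j, by simpa using hj⟩)
    ?_ ?_ ?_ ?_ ?_
  · intro j _; exact Finset.mem_filter.2 ⟨Finset.mem_univ _, Fin.lt_def.2 j.2⟩
  · intro j _; simp
  · intro j _; simp
  · intro j _; simp
  · intro j _; rfl

theorem finSigma_lt_of_lt {k : ℕ} {n : Fin k → ℕ} {i j : Fin k} (h : i < j) (a : Fin (n i))
    (b : Fin (n j)) : (finSigmaFinEquiv ⟨i, a⟩ : Fin (∑ i, n i)) < finSigmaFinEquiv ⟨j, b⟩ := by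
  rw [Fin.lt_def, finSigma_val, finSigma_val]
  have h1 : (∑ l : Fin k, if l < i then n l else 0) + n i ≤ ∑ l : Fin k, if l < j then n l else 0 := by
    have h2 : n i = ∑ l : Fin k, if l = i then n l else 0 := by simp
    conv_lhs => rw [h2]
    rw [← Finset.sum_add_distrib]
    apply Finset.sum_le_sum
    intro l _
    by_cases hl : l < i
    · simp [hl, hl.ne, hl.trans h]
    · by_cases hl' : l = i
      · subst hl'; simp [h]
      · simp [hl, hl']
  have := a.2
  omega

theorem finSigma_lt_iff {k : ℕ} {n : Fin k → ℕ} (s t : Σ i, Fin (n i)) :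
    (finSigmaFinEquiv s : Fin (∑ i, n i)) < finSigmaFinEquiv t ↔
      s.1 < t.1 ∨ s.1 = t.1 ∧ (s.2 : ℕ) < t.2 := by
  obtain ⟨i, a⟩ := s
  obtain ⟨j, b⟩ := t
  rcases lt_trichotomy i j with h | h | h
  · simp [finSigma_lt_of_lt h a b, h]
  · subst h
    rw [Fin.lt_def, finSigma_val, finSigma_val]
    simp
  · have := (finSigma_lt_of_lt h b a).not_gt
    simp [this, h.not_gt, h.ne']

theorem finSigma_assoc {k : ℕ} {n : Fin k → ℕ} {N : Fin (∑ i, n i) → ℕ} (i : Fin k)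
    (j : Fin (n i)) (l : Fin (N (finSigmaFinEquiv ⟨i, j⟩))) :
    (finSigmaFinEquiv (n := N) ⟨finSigmaFinEquiv ⟨i, j⟩, l⟩ : ℕ) =
      finSigmaFinEquiv (n := fun i => ∑ j, N (finSigmaFinEquiv ⟨i, j⟩))
        ⟨i, finSigmaFinEquiv (n := fun j => N (finSigmaFinEquiv ⟨i, j⟩)) ⟨j, l⟩⟩ := by
  rw [finSigma_val, finSigma_val, finSigma_val, ← add_assoc]
  congr 1
  rw [← finSigmaFinEquiv.sum_comp, Fintype.sum_sigma]
  simp only [finSigma_lt_iff]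
  have : ∀ i' : Fin k, (∑ j' : Fin (n i'), if i' < i ∨ i' = i ∧ (j' : ℕ) < j then
      N (finSigmaFinEquiv ⟨i', j'⟩) else 0) =
      (if i' < i then ∑ j' : Fin (n i'), N (finSigmaFinEquiv ⟨i', j'⟩) else 0) +
      (if i' = i then ∑ j' : Fin (n i'), (if (j' : ℕ) < j then N (finSigmaFinEquiv ⟨i', j'⟩) else 0) else 0) := by
    intro i'
    by_cases h : i' < i
    · simp [h, h.ne]
    · by_cases h' : i' = i
      · simp [h']
      · simp [h, h']
  simp only [this, Finset.sum_add_distrib]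
  simp

/-- The sum of the sizes of nested blocks does not depend on the bracketing. -/
theorem sum_finSigma {k : ℕ} (n : Fin k → ℕ) (N : Fin (∑ i, n i) → ℕ) :
    ∑ a, N a = ∑ i, ∑ j, N (finSigmaFinEquiv ⟨i, j⟩) := by
  rw [← finSigmaFinEquiv.sum_comp, Fintype.sum_sigma]

/-- Concatenation of tuples. -/
def flatten {α : Type*} {k : ℕ} {n : Fin k → ℕ} (v : ∀ i, Fin (n i) → α) : Fin (∑ i, n i) → α :=
  fun a => v (finSigmaFinEquiv.symm a).1 (finSigmaFinEquiv.symm a).2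

@[simp]
theorem flatten_apply {α : Type*} {k : ℕ} {n : Fin k → ℕ} (v : ∀ i, Fin (n i) → α) (i : Fin k)
    (j : Fin (n i)) : flatten v (finSigmaFinEquiv ⟨i, j⟩) = v i j := by
  unfold flatten
  rw [Equiv.symm_apply_apply]

theorem sum_flatten {k : ℕ} {n : Fin k → ℕ} (d : ∀ i, Fin (n i) → ℕ) :
    ∑ a, flatten d a = ∑ i, ∑ j, d i j := by
  rw [sum_finSigma]; simp

/-- Permutation of `k` blocks of sizes `n (σ 0), ..., n (σ (k - 1))` along `σ`. -/
def blockPerm {k l : ℕ} (σ : Fin k ≃ Fin l) (n : Fin l → ℕ) :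
    Fin (∑ i, n (σ i)) ≃ Fin (∑ j, n j) :=
  (finSigmaFinEquiv.symm.trans (Equiv.sigmaCongrLeft (β := fun j => Fin (n j)) σ)).trans
    finSigmaFinEquiv

/-- Juxtaposition of bijections. -/
def blockSum {k : ℕ} {m n : Fin k → ℕ} (e : ∀ i, Fin (m i) ≃ Fin (n i)) :
    Fin (∑ i, m i) ≃ Fin (∑ i, n i) :=
  (finSigmaFinEquiv.symm.trans (Equiv.sigmaCongrRight e)).trans finSigmaFinEquiv

/-- The transposition `σ_{p,n}`, which sends the `k`-th element of the `i`-th of `p` blocks of size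
`n` to the `i`-th element of the `k`-th of `n` blocks of size `p`. -/
def blockTranspose (p n : ℕ) : Fin (∑ _ : Fin p, n) ≃ Fin (∑ _ : Fin n, p) :=
  finSigmaFinEquiv.symm.trans <| (Equiv.sigmaEquivProd (Fin p) (Fin n)).trans <|
    (Equiv.prodComm (Fin p) (Fin n)).trans <|
      (Equiv.sigmaEquivProd (Fin n) (Fin p)).symm.trans finSigmaFinEquiv

@[simp]
theorem blockPerm_apply {k l : ℕ} (σ : Fin k ≃ Fin l) (n : Fin l → ℕ) (i : Fin k)
    (j : Fin (n (σ i))) :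
    blockPerm σ n (finSigmaFinEquiv ⟨i, j⟩) = finSigmaFinEquiv ⟨σ i, j⟩ := by
  simp [blockPerm]

@[simp]
theorem blockSum_apply {k : ℕ} {m n : Fin k → ℕ} (e : ∀ i, Fin (m i) ≃ Fin (n i)) (i : Fin k)
    (j : Fin (m i)) :
    blockSum e (finSigmaFinEquiv ⟨i, j⟩) = finSigmaFinEquiv ⟨i, e i j⟩ := by
  simp [blockSum]

theorem forall_flat {k : ℕ} {n : Fin k → ℕ} {Q : Fin (∑ i, n i) → Prop} :
    (∀ a, Q a) ↔ ∀ i j, Q (finSigmaFinEquiv ⟨i, j⟩) := by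
  constructor
  · intro h i j; exact h _
  · intro h a
    obtain ⟨⟨i, j⟩, rfl⟩ := finSigmaFinEquiv.surjective a
    exact h i j

end Flatten

section Sign

/-- The sign by which a bijection `e` acts on a tensor product of homogeneous elements of degrees
`d 0, ..., d (m - 1)`. For `ε = 1` there are no signs; for `ε = -1` this is the Koszul sign. -/
def koszulSign (ε : ℤˣ) {m n : ℕ} (d : Fin m → ℕ) (e : Fin m ≃ Fin n) : ℤˣ :=
  ∏ i, ∏ j, if i < j ∧ e j < e i then ε ^ (d i * d j) else 1

theorem koszulSign_of_monotone (ε : ℤˣ) {m n : ℕ} (d : Fin m → ℕ) (e : Fin m ≃ Fin n)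
    (he : ∀ i j, i < j → e i < e j) : koszulSign ε d e = 1 := by
  unfold koszulSign
  refine Finset.prod_eq_one fun i _ => Finset.prod_eq_one fun j _ => ?_
  rw [if_neg]
  rintro ⟨h, h'⟩
  exact (he i j h).not_gt h'

theorem koszulSign_blockSum (ε : ℤˣ) {k : ℕ} {m n : Fin k → ℕ} (e : ∀ i, Fin (m i) ≃ Fin (n i))
    (d : ∀ i, Fin (m i) → ℕ) :
    koszulSign ε (flatten d) (blockSum e) = ∏ i, koszulSign ε (d i) (e i) := by
  unfold koszulSign
  rw [← finSigmaFinEquiv.prod_comp, Fintype.prod_sigma]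
  refine Finset.prod_congr rfl fun i _ => Finset.prod_congr rfl fun a _ => ?_
  rw [← finSigmaFinEquiv.prod_comp, Fintype.prod_sigma, Finset.prod_eq_single i]
  · refine Finset.prod_congr rfl fun b _ => ?_
    simp only [blockSum_apply, flatten_apply, finSigma_lt_iff]
    simp
  · intro j _ hj
    refine Finset.prod_eq_one fun b _ => ?_
    simp only [blockSum_apply, flatten_apply, finSigma_lt_iff]
    rw [if_neg]
    rintro ⟨h1, h2⟩
    have h1' : i < j := by simpa [Ne.symm hj] using h1
    have h2' : j < i := by simpa [hj] using h2
    exact h1'.not_gt h2'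
  · simp

theorem koszulSign_blockPerm (ε : ℤˣ) {k l : ℕ} (σ : Fin k ≃ Fin l) (n : Fin l → ℕ)
    (d : ∀ i, Fin (n (σ i)) → ℕ) :
    koszulSign ε (flatten d) (blockPerm σ n) = koszulSign ε (fun i => ∑ a, d i a) σ := by
  unfold koszulSign
  rw [← finSigmaFinEquiv.prod_comp, Fintype.prod_sigma]
  refine Finset.prod_congr rfl fun i _ => ?_
  have : ∀ a : Fin (n (σ i)), (∏ j, if finSigmaFinEquiv ⟨i, a⟩ < j ∧
      blockPerm σ n j < blockPerm σ n (finSigmaFinEquiv ⟨i, a⟩) then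
      ε ^ (flatten d (finSigmaFinEquiv ⟨i, a⟩) * flatten d j) else 1) =
      ∏ j, ∏ b, if i < j ∧ σ j < σ i then ε ^ (d i a * d j b) else 1 := by
    intro a
    rw [← finSigmaFinEquiv.prod_comp, Fintype.prod_sigma]
    refine Finset.prod_congr rfl fun j _ => Finset.prod_congr rfl fun b _ => ?_
    simp only [blockPerm_apply, flatten_apply, finSigma_lt_iff]
    refine if_congr ?_ rfl rfl
    by_cases hij : i = j
    · subst hij
      simp only [lt_irrefl, false_or, true_and, and_self, iff_false, not_and, not_lt]
      exact fun h => h.le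
    · have : σ j ≠ σ i := fun h => hij (σ.injective h).symm
      simp [hij, this]
  simp only [this]
  rw [Finset.prod_comm]
  refine Finset.prod_congr rfl fun j _ => ?_
  by_cases h : i < j ∧ σ j < σ i
  · simp only [h, and_self, if_true, Finset.prod_pow_eq_pow_sum, Finset.sum_mul_sum]
  · simp only [h, if_false, Finset.prod_const_one]

end Sign

section Graded

/-- An `ℕ`-graded vector space, with its underlying (ungraded) vector space `carrier`. -/
structure GradedSpace (F : Type w) [Field F] where
  carrier : Type v
  [grp : AddCommGroup carrier]
  [mod : Module F carrier]
  /-- The subspace of homogeneous elements of degree `d`. -/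
  deg : ℕ → Submodule F carrier
  isInternal : DirectSum.IsInternal deg

namespace GradedSpace

attribute [instance] GradedSpace.grp GradedSpace.mod

variable {F : Type w} [Field F]

instance : CoeSort (GradedSpace.{w, v} F) (Type v) := ⟨GradedSpace.carrier⟩

theorem bijective_coeLinearMap (V : GradedSpace.{w, v} F) :
    Function.Bijective (DirectSum.coeLinearMap V.deg) := V.isInternal

/-- The identification of a graded vector space with the direct sum of its homogeneous parts. -/
noncomputable def decomp (V : GradedSpace.{w, v} F) : (⨁ i, V.deg i) ≃ₗ[F] V :=
  LinearEquiv.ofBijective (DirectSum.coeLinearMap V.deg) V.bijective_coeLinearMap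

/-- The homogeneous component of degree `d`. -/
noncomputable def proj (V : GradedSpace.{w, v} F) (d : ℕ) : V →ₗ[F] V :=
  (V.deg d).subtype ∘ₗ DirectSum.component F ℕ (fun i => V.deg i) d ∘ₗ V.decomp.symm.toLinearMap

variable (V : GradedSpace.{w, v} F)

theorem proj_mem (d : ℕ) (x : V) : V.proj d x ∈ V.deg d := by
  exact Submodule.coe_mem _

theorem proj_of_mem (d : ℕ) {i : ℕ} {x : V} (hx : x ∈ V.deg i) :
    V.proj d x = if d = i then x else 0 := by
  have h : V.decomp.symm x = DirectSum.lof F ℕ (fun i => V.deg i) i ⟨x, hx⟩ := by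
    rw [LinearEquiv.symm_apply_eq, decomp, LinearEquiv.ofBijective_apply,
      DirectSum.coeLinearMap_lof]
  simp only [proj, LinearMap.comp_apply, LinearEquiv.coe_coe, h]
  by_cases hd : d = i
  · subst hd
    simp [DirectSum.component.lof_self]
  · rw [DirectSum.component.of]
    simp [hd, Ne.symm hd]

theorem span_homogeneous : Submodule.span F {x : V | ∃ d, x ∈ V.deg d} = ⊤ := by
  rw [eq_top_iff, ← V.isInternal.submodule_iSup_eq_top, iSup_le_iff]
  exact fun d x hx => Submodule.subset_span ⟨d, hx⟩

theorem isInternal_of_proj {M : Type*} [AddCommGroup M] [Module F M] (deg : ℕ → Submodule F M)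
    (π : ℕ → M →ₗ[F] M) (hπ : ∀ d i x, x ∈ deg i → π d x = if d = i then x else 0)
    (htop : ⨆ d, deg d = ⊤) : DirectSum.IsInternal deg := by
  rw [DirectSum.isInternal_submodule_iff_iSupIndep_and_iSup_eq_top]
  refine ⟨fun d => ?_, htop⟩
  rw [Submodule.disjoint_def]
  intro x hx hx'
  have h1 : π d x = x := by simp [hπ d d x hx]
  have h2 : (⨆ j, ⨆ (_ : j ≠ d), deg j) ≤ LinearMap.ker (π d) := by
    refine iSup_le fun j => iSup_le fun hj y hy => ?_
    simp [hπ d j y hy, Ne.symm hj]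
  rw [← h1]
  exact h2 hx'

end GradedSpace

end Graded

section Operads

/-- A symmetric operad in `F`-vector spaces. The right actions of the symmetric groups are recorded
as a contravariant action of the groupoid of bijections `Fin m ≃ Fin n` (such a bijection exists
only if `m = n`), so that the actions of the `finCongr` are the transports along equalities of
arities. The conventions are those of the operad of endomorphisms of a vector space, where
`(act e μ) (x) = μ (x ∘ e⁻¹)`. -/
structure Operad (F : Type w) [Field F] where
  /-- The space of operations of arity `n`. -/
  Op : ℕ → Type u
  [grp : ∀ n, AddCommGroup (Op n)]
  [mod : ∀ n, Module F (Op n)]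
  act : ∀ {m n : ℕ}, (Fin m ≃ Fin n) → Op n →ₗ[F] Op m
  act_refl : ∀ {n : ℕ} (μ : Op n), act (Equiv.refl (Fin n)) μ = μ
  act_trans : ∀ {l m n : ℕ} (e : Fin l ≃ Fin m) (f : Fin m ≃ Fin n) (μ : Op n),
    act (e.trans f) μ = act e (act f μ)
  one : Op 1
  /-- The composition `μ (ν 0, ..., ν (k - 1))`. -/
  comp : ∀ {k : ℕ} (n : Fin k → ℕ),
    Op k →ₗ[F] MultilinearMap F (fun i => Op (n i)) (Op (∑ i, n i))
  one_comp : ∀ {n : ℕ} (ν : Op n),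
    comp (fun _ : Fin 1 => n) one (fun _ => ν) = act (finCongr (by simp)) ν
  comp_one : ∀ {n : ℕ} (μ : Op n),
    comp (fun _ : Fin n => 1) μ (fun _ => one) = act (finCongr (by simp)) μ
  assoc : ∀ {k : ℕ} (n : Fin k → ℕ) (N : Fin (∑ i, n i) → ℕ) (μ : Op k) (ν : ∀ i, Op (n i))
    (ξ : ∀ a, Op (N a)),
    comp N (comp n μ ν) ξ =
      act (finCongr (sum_finSigma n N))
        (comp (fun i => ∑ j, N (finSigmaFinEquiv ⟨i, j⟩)) μ
          fun i => comp (fun j => N (finSigmaFinEquiv ⟨i, j⟩)) (ν i)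
            fun j => ξ (finSigmaFinEquiv ⟨i, j⟩))
  comp_act_left : ∀ {k l : ℕ} (σ : Fin k ≃ Fin l) (n : Fin l → ℕ) (μ : Op l) (ν : ∀ j, Op (n j)),
    comp (fun i => n (σ i)) (act σ μ) (fun i => ν (σ i)) = act (blockPerm σ n) (comp n μ ν)
  comp_act_right : ∀ {k : ℕ} (m n : Fin k → ℕ) (e : ∀ i, Fin (m i) ≃ Fin (n i)) (μ : Op k)
    (ν : ∀ i, Op (n i)),
    comp m μ (fun i => act (e i) (ν i)) = act (blockSum e) (comp n μ ν)

namespace Operad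

attribute [instance] Operad.grp Operad.mod

variable {F : Type w} [Field F]

/-- `star` is invariant under the symmetric group, i.e. a completely symmetric operation. -/
def IsSymmetric (P : Operad.{w, u} F) {p : ℕ} (star : P.Op p) : Prop :=
  ∀ σ : Equiv.Perm (Fin p), P.act σ star = star

/-- The interchange relation `star (μ, ..., μ) = μ (star, ..., star) · σ_{p,n}` of a `p`-ary
operation `star` with all operations `μ`. -/
def IsCentral (P : Operad.{w, u} F) {p : ℕ} (star : P.Op p) : Prop :=
  ∀ (n : ℕ) (μ : P.Op n),
    P.comp (fun _ : Fin p => n) star (fun _ => μ) =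
      P.act (blockTranspose p n) (P.comp (fun _ : Fin n => p) μ (fun _ => star))

end Operad

/-- A graded `P`-algebra, for the operad `P` placed in degree `0`. The symmetry of the tensor product
of graded vector spaces is `x ⊗ y ↦ ε ^ (|x| |y|) y ⊗ x`: without signs for `ε = 1`, with Koszul signs
for `ε = -1`. -/
structure PAlgebra {F : Type w} [Field F] (ε : ℤˣ) (P : Operad.{w, u} F) extends
    GradedSpace.{w, v} F where
  /-- The operation `(x 0, ..., x (n - 1)) ↦ μ (x 0, ..., x (n - 1))`. -/
  op : ∀ {n : ℕ}, P.Op n →ₗ[F] MultilinearMap F (fun _ : Fin n => carrier) carrier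
  op_deg : ∀ {n : ℕ} (μ : P.Op n) (d : Fin n → ℕ) (x : Fin n → carrier),
    (∀ i, x i ∈ deg (d i)) → op μ x ∈ deg (∑ i, d i)
  op_one : ∀ x : Fin 1 → carrier, op P.one x = x 0
  op_act : ∀ {m n : ℕ} (e : Fin m ≃ Fin n) (μ : P.Op n) (d : Fin m → ℕ) (x : Fin m → carrier),
    (∀ i, x i ∈ deg (d i)) → op (P.act e μ) x = koszulSign ε d e • op μ (x ∘ e.symm)
  op_comp : ∀ {k : ℕ} (n : Fin k → ℕ) (μ : P.Op k) (ν : ∀ i, P.Op (n i))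
    (x : ∀ i, Fin (n i) → carrier),
    op (P.comp n μ ν) (flatten x) = op μ (fun i => op (ν i) (x i))

/-- An isomorphism of graded `P`-algebras. -/
structure PAlgebra.Iso {F : Type w} [Field F] {ε : ℤˣ} {P : Operad.{w, u} F}
    (A B : PAlgebra ε P) where
  toLinearEquiv : A.carrier ≃ₗ[F] B.carrier
  map_deg : ∀ (d : ℕ) (x : A.carrier), toLinearEquiv x ∈ B.deg d ↔ x ∈ A.deg d
  map_op : ∀ {n : ℕ} (μ : P.Op n) (x : Fin n → A.carrier),
    toLinearEquiv (A.op μ x) = B.op μ (fun i => toLinearEquiv (x i))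

end Operads

section Schur

variable {F : Type w} [Field F] (ε : ℤˣ) (P : Operad.{w, u} F) (V : GradedSpace.{w, v} F)

/-- The relations `(μ · σ) ⊗ x = μ ⊗ (σ x)` on `P(n) ⊗ V^{⊗ n}`. -/
def symRel (n : ℕ) : Submodule F (P.Op n ⊗[F] PiTensorProduct F (fun _ : Fin n => V.carrier)) :=
  Submodule.span F {z | ∃ (σ : Equiv.Perm (Fin n)) (μ : P.Op n) (d : Fin n → ℕ) (x : Fin n → V),
    (∀ i, x i ∈ V.deg (d i)) ∧
      z = P.act σ μ ⊗ₜ[F] PiTensorProduct.tprod F x -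
        koszulSign ε d σ • μ ⊗ₜ[F] PiTensorProduct.tprod F (x ∘ σ.symm)}

/-- The coinvariants `P(n) ⊗_{Σ_n} V^{⊗ n}`. -/
abbrev SchurSummand (n : ℕ) : Type (max u v w) :=
  (P.Op n ⊗[F] PiTensorProduct F (fun _ : Fin n => V.carrier)) ⧸ symRel ε P V n

/-- The Schur functor `S(P, V) = ⨁ n, P(n) ⊗_{Σ_n} V^{⊗ n}`. -/
def Schur : Type (max u v w) := ⨁ n, SchurSummand ε P V n

noncomputable instance : AddCommGroup (Schur ε P V) :=
  inferInstanceAs (AddCommGroup (⨁ n, SchurSummand ε P V n))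

noncomputable instance : Module F (Schur ε P V) :=
  inferInstanceAs (Module F (⨁ n, SchurSummand ε P V n))

/-- The inclusion of a summand. -/
noncomputable def Schur.incl (n : ℕ) : SchurSummand ε P V n →ₗ[F] Schur ε P V :=
  DirectSum.lof F ℕ (SchurSummand ε P V) n

variable {ε P V}

/-- The monomial `(μ; x 0, ..., x (n - 1))` in `P(n) ⊗_{Σ_n} V^{⊗ n}`. -/
noncomputable def monS {n : ℕ} :
    P.Op n →ₗ[F] MultilinearMap F (fun _ : Fin n => V) (SchurSummand ε P V n) where
  toFun μ := ((symRel ε P V n).mkQ ∘ₗ TensorProduct.mk F _ _ μ).compMultilinearMap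
    (PiTensorProduct.tprod F)
  map_add' μ ν := by ext x; simp
  map_smul' c μ := by ext x; simp

/-- The monomial `(μ; x 0, ..., x (n - 1))` in `S(P, V)`. -/
noncomputable def mon {n : ℕ} :
    P.Op n →ₗ[F] MultilinearMap F (fun _ : Fin n => V) (Schur ε P V) where
  toFun μ := (Schur.incl ε P V n).compMultilinearMap (monS μ)
  map_add' μ ν := by ext1 x; simp
  map_smul' c μ := by ext1 x; simp

theorem mon_apply {n : ℕ} (μ : P.Op n) (x : Fin n → V) :
    (mon μ x : Schur ε P V) = Schur.incl ε P V n (monS μ x) := rfl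

theorem monS_act {n : ℕ} (σ : Equiv.Perm (Fin n)) (μ : P.Op n) (d : Fin n → ℕ) (x : Fin n → V)
    (hx : ∀ i, x i ∈ V.deg (d i)) :
    (monS (P.act σ μ) x : SchurSummand ε P V n) = koszulSign ε d σ • monS μ (x ∘ σ.symm) := by
  rw [← sub_eq_zero]
  have : (symRel ε P V n).mkQ (P.act σ μ ⊗ₜ[F] PiTensorProduct.tprod F x -
        koszulSign ε d σ • μ ⊗ₜ[F] PiTensorProduct.tprod F (x ∘ σ.symm)) = 0 := by
    rw [Submodule.mkQ_apply, Submodule.Quotient.mk_eq_zero]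
    exact Submodule.subset_span ⟨σ, μ, d, x, hx, rfl⟩
  rw [← this, Units.smul_def, Units.smul_def, map_sub, map_zsmul]
  rfl

theorem mon_act {m n : ℕ} (e : Fin m ≃ Fin n) (μ : P.Op n) (d : Fin m → ℕ) (x : Fin m → V)
    (hx : ∀ i, x i ∈ V.deg (d i)) :
    (mon (P.act e μ) x : Schur ε P V) = koszulSign ε d e • mon μ (x ∘ e.symm) := by
  obtain rfl : m = n := Fin.equiv_iff_eq.1 ⟨e⟩
  rw [mon_apply, monS_act e μ d x hx, mon_apply, Units.smul_def, Units.smul_def, map_zsmul]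

theorem mon_finCongr {m n : ℕ} (h : m = n) (μ : P.Op n) (x : Fin m → V) :
    (mon (P.act (finCongr h) μ) x : Schur ε P V) = mon μ (x ∘ (finCongr h).symm) := by
  subst h
  have : P.act (finCongr rfl) μ = μ := P.act_refl μ
  rw [this]
  rfl

variable {W : Type*} [AddCommGroup W] [Module F W]

/-- The universal property of `P(n) ⊗_{Σ_n} V^{⊗ n}`. -/
noncomputable def liftS {n : ℕ} (f : P.Op n →ₗ[F] MultilinearMap F (fun _ : Fin n => V) W)
    (hf : ∀ (σ : Equiv.Perm (Fin n)) (μ : P.Op n) (d : Fin n → ℕ) (x : Fin n → V),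
      (∀ i, x i ∈ V.deg (d i)) → f (P.act σ μ) x = koszulSign ε d σ • f μ (x ∘ σ.symm)) :
    SchurSummand ε P V n →ₗ[F] W :=
  (symRel ε P V n).liftQ
    (TensorProduct.lift ((PiTensorProduct.lift (R := F)).toLinearMap ∘ₗ f)) <| by
    rw [symRel, Submodule.span_le]
    rintro _ ⟨σ, μ, d, x, hx, rfl⟩
    simp [hf σ μ d x hx, Units.smul_def]

theorem liftS_monS {n : ℕ} (f : P.Op n →ₗ[F] MultilinearMap F (fun _ : Fin n => V) W)
    (hf : ∀ (σ : Equiv.Perm (Fin n)) (μ : P.Op n) (d : Fin n → ℕ) (x : Fin n → V),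
      (∀ i, x i ∈ V.deg (d i)) → f (P.act σ μ) x = koszulSign ε d σ • f μ (x ∘ σ.symm))
    (μ : P.Op n) (x : Fin n → V) : liftS f hf (monS μ x) = f μ x := by
  simp [liftS, monS]

/-- The universal property of the vector space `S(P, V)`. -/
noncomputable def lift (f : ∀ n, P.Op n →ₗ[F] MultilinearMap F (fun _ : Fin n => V) W)
    (hf : ∀ n (σ : Equiv.Perm (Fin n)) (μ : P.Op n) (d : Fin n → ℕ) (x : Fin n → V),
      (∀ i, x i ∈ V.deg (d i)) → f n (P.act σ μ) x = koszulSign ε d σ • f n μ (x ∘ σ.symm)) :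
    Schur ε P V →ₗ[F] W :=
  DirectSum.toModule F ℕ W fun n => liftS (f n) (hf n)

theorem lift_mon (f : ∀ n, P.Op n →ₗ[F] MultilinearMap F (fun _ : Fin n => V) W)
    (hf : ∀ n (σ : Equiv.Perm (Fin n)) (μ : P.Op n) (d : Fin n → ℕ) (x : Fin n → V),
      (∀ i, x i ∈ V.deg (d i)) → f n (P.act σ μ) x = koszulSign ε d σ • f n μ (x ∘ σ.symm))
    {n : ℕ} (μ : P.Op n) (x : Fin n → V) : lift f hf (mon μ x) = f n μ x := by
  rw [← liftS_monS (f n) (hf n)]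
  exact DirectSum.toModule_lof F n _

variable (P V) in
/-- Data for a monomial in homogeneous elements. -/
structure HomMon (n : ℕ) where
  coeff : P.Op n
  degs : Fin n → ℕ
  vec : Fin n → V
  vec_mem : ∀ i, vec i ∈ V.deg (degs i)

theorem span_monS (n : ℕ) : Submodule.span F (Set.range fun h : HomMon P V n =>
    (monS h.coeff h.vec : SchurSummand ε P V n)) = ⊤ := by
  rw [eq_top_iff, ← Submodule.range_mkQ (symRel ε P V n), LinearMap.range_eq_map,
    Submodule.map_le_iff_le_comap, ← TensorProduct.span_tmul_eq_top, Submodule.span_le]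
  rintro _ ⟨μ, t, rfl⟩
  have ht : t ∈ Submodule.span F (Set.range (PiTensorProduct.tprod F (s := fun _ : Fin n => V))) := by
    rw [PiTensorProduct.span_tprod_eq_top]; trivial
  rw [SetLike.mem_coe, Submodule.mem_comap]
  induction ht using Submodule.span_induction with
  | mem t ht =>
    obtain ⟨x, rfl⟩ := ht
    set K := Submodule.span F (Set.range fun h : HomMon P V n =>
      (monS h.coeff h.vec : SchurSummand ε P V n)) with hK
    have : (K.mkQ.compMultilinearMap (monS (ε := ε) (V := V) μ)) x = 0 := by
      refine multilinear_eq_zero _ (fun _ => {x : V | ∃ d, x ∈ V.deg d}) ?_ x ?_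
      · intro y hy
        choose d hd using hy
        rw [LinearMap.compMultilinearMap_apply, Submodule.mkQ_apply, Submodule.Quotient.mk_eq_zero]
        exact Submodule.subset_span ⟨⟨μ, d, y, hd⟩, rfl⟩
      · intro i; rw [V.span_homogeneous]; trivial
    rw [LinearMap.compMultilinearMap_apply, Submodule.mkQ_apply, Submodule.Quotient.mk_eq_zero] at this
    exact this
  | zero => simp
  | add s t _ _ h1 h2 => rw [TensorProduct.tmul_add, map_add]; exact add_mem h1 h2
  | smul c t _ h => rw [TensorProduct.tmul_smul, map_smul]; exact Submodule.smul_mem _ _ h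

variable (ε P V) in
/-- The set of all monomials in homogeneous elements, of total degree `d`. -/
def homMons (d : ℕ) : Set (Schur ε P V) :=
  {z | ∃ (n : ℕ) (h : HomMon P V n), ∑ i, h.degs i = d ∧ z = mon h.coeff h.vec}

theorem span_homMons : Submodule.span F {z | ∃ d, z ∈ homMons ε P V d} = ⊤ := by
  rw [eq_top_iff]
  rintro z -
  induction z using DirectSum.induction_on (β := SchurSummand ε P V) with
  | zero => exact zero_mem _
  | add x y hx hy => exact add_mem hx hy
  | of n x =>
    have hx : x ∈ Submodule.span F (Set.range fun h : HomMon P V n =>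
      (monS h.coeff h.vec : SchurSummand ε P V n)) := by rw [span_monS]; trivial
    have := Submodule.mem_map_of_mem (f := Schur.incl ε P V n) hx
    rw [Submodule.map_span] at this
    refine Submodule.span_mono ?_ this
    rintro _ ⟨_, ⟨h, rfl⟩, rfl⟩
    exact ⟨_, n, h, rfl, rfl⟩

theorem schur_hom_ext {f g : Schur ε P V →ₗ[F] W}
    (h : ∀ n (h : HomMon P V n), f (mon h.coeff h.vec) = g (mon h.coeff h.vec)) : f = g := by
  refine LinearMap.ext_on_range (v := fun z : {z // ∃ d, z ∈ homMons ε P V d} => z.1) ?_ ?_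
  · exact (congrArg _ Subtype.range_coe).trans span_homMons
  · rintro ⟨_, d, n, hh, _, rfl⟩
    exact h n hh

variable (ε P V) in
/-- The family of maps defining the homogeneous components of `S(P, V)`. -/
noncomputable def projFam (d n : ℕ) :
    P.Op n →ₗ[F] MultilinearMap F (fun _ : Fin n => V.carrier) (Schur ε P V) where
  toFun μ := ∑ e ∈ Finset.piAntidiag Finset.univ d,
    (mon μ).compLinearMap fun i => V.proj (e i)
  map_add' μ ν := by ext1 x; simp [Finset.sum_add_distrib]
  map_smul' c μ := by ext1 x; simp [Finset.smul_sum]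

theorem projFam_apply (d n : ℕ) (μ : P.Op n) (c : Fin n → ℕ) (x : Fin n → V)
    (hx : ∀ i, x i ∈ V.deg (c i)) :
    projFam ε P V d n μ x = if d = ∑ i, c i then mon μ x else 0 := by
  have h : projFam ε P V d n μ x = ∑ e ∈ Finset.piAntidiag Finset.univ d,
      mon μ (fun i => V.proj (e i) (x i)) := by
    simp [projFam]
  rw [h]
  have h0 : ∀ e : Fin n → ℕ, e ≠ c → (mon μ (fun i => V.proj (e i) (x i)) : Schur ε P V) = 0 := by
    intro e he
    obtain ⟨i, hi⟩ := Function.ne_iff.1 he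
    apply (mon μ).map_coord_zero i
    rw [V.proj_of_mem _ (hx i), if_neg hi]
  have h1 : (fun i => V.proj (c i) (x i)) = x := by
    funext i
    rw [V.proj_of_mem _ (hx i), if_pos rfl]
  split_ifs with hd
  · rw [Finset.sum_eq_single c (fun e _ he => h0 e he), h1]
    intro hc
    simp [hd] at hc
  · refine Finset.sum_eq_zero fun e he => h0 e ?_
    rintro rfl
    simp at he
    exact hd he.symm

variable (ε P V) in
/-- The homogeneous components of `S(P, V)`. -/
noncomputable def schurProj (d : ℕ) : Schur ε P V →ₗ[F] Schur ε P V :=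
  lift (W := Schur ε P V) (projFam ε P V d) <| by
    intro n σ μ c x hx
    have hx' : ∀ i, (x ∘ σ.symm) i ∈ V.deg ((c ∘ σ.symm) i) := fun i => hx _
    rw [projFam_apply d n _ c x hx, projFam_apply d n μ _ _ hx', mon_act σ μ c x hx]
    have : ∑ i, (c ∘ σ.symm) i = ∑ i, c i := Equiv.sum_comp σ.symm c
    rw [this]
    split_ifs <;> simp

theorem schurProj_of_mem (d i : ℕ) (x : Schur ε P V)
    (hx : x ∈ Submodule.span F (homMons ε P V i)) :
    schurProj ε P V d x = if d = i then x else 0 := by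
  induction hx using Submodule.span_induction with
  | mem x hx =>
    obtain ⟨n, h, rfl, rfl⟩ := hx
    rw [schurProj, lift_mon, projFam_apply d n _ _ _ h.vec_mem]
  | zero => simp
  | add x y _ _ h1 h2 => rw [map_add, h1, h2]; split_ifs <;> simp
  | smul c x _ h1 => rw [map_smul, h1]; split_ifs <;> simp

variable (ε P V) in
/-- The graded vector space `S(P, V)`: a monomial `(μ; x 0, ..., x (n - 1))` in homogeneous elements
has degree `|x 0| + ... + |x (n - 1)|`. -/
noncomputable def schurSpace : GradedSpace.{w, max u v w} F where
  carrier := Schur ε P V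
  deg d := Submodule.span F (homMons ε P V d)
  isInternal := by
    refine GradedSpace.isInternal_of_proj _ (schurProj ε P V) schurProj_of_mem ?_
    rw [eq_top_iff, ← span_homMons, Submodule.span_le]
    rintro z ⟨d, hz⟩
    exact Submodule.mem_iSup_of_mem d (Submodule.subset_span hz)

theorem flatten_update {α : Type*} {k : ℕ} {n : Fin k → ℕ} (w : ∀ i, Fin (n i) → α) (i : Fin k)
    (v : Fin (n i) → α) (j : Fin (n i)) (z : α) :
    flatten (Function.update w i (Function.update v j z)) =
      Function.update (flatten (Function.update w i v)) (finSigmaFinEquiv ⟨i, j⟩) z := by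
  funext a
  revert a
  rw [forall_flat]
  intro i' j'
  rw [flatten_apply]
  by_cases hi : i' = i
  · subst hi
    by_cases hj : j' = j
    · subst hj; simp
    · have : (finSigmaFinEquiv ⟨i', j'⟩ : Fin (∑ i, n i)) ≠ finSigmaFinEquiv ⟨i', j⟩ := by
        simpa using hj
      simp [this, hj]
  · have : (finSigmaFinEquiv ⟨i', j'⟩ : Fin (∑ i, n i)) ≠ finSigmaFinEquiv ⟨i, j⟩ := by
      simp [hi]
    simp [this, hi]

theorem flatten_comp_blockSum_symm {α : Type*} {k : ℕ} {m n : Fin k → ℕ}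
    (e : ∀ i, Fin (m i) ≃ Fin (n i)) (v : ∀ i, Fin (m i) → α) :
    flatten v ∘ (blockSum e).symm = flatten fun i => v i ∘ (e i).symm := by
  rw [← Function.Surjective.right_cancellable (blockSum e).surjective]
  funext a
  revert a
  rw [forall_flat]
  intro i j
  simp only [Function.comp_apply, Equiv.symm_apply_apply]
  simp

theorem flatten_comp_blockPerm_symm {α : Type*} {k l : ℕ} (σ : Fin k ≃ Fin l) (n : Fin l → ℕ)
    (v : ∀ j, Fin (n j) → α) :
    flatten (fun i => v (σ i)) ∘ (blockPerm σ n).symm = flatten v := by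
  rw [← Function.Surjective.right_cancellable (blockPerm σ n).surjective]
  funext a
  revert a
  rw [forall_flat]
  intro i j
  simp only [Function.comp_apply, Equiv.symm_apply_apply]
  simp

theorem flatten_mem {k : ℕ} {n : Fin k → ℕ} (d : ∀ i, Fin (n i) → ℕ) (v : ∀ i, Fin (n i) → V)
    (h : ∀ i j, v i j ∈ V.deg (d i j)) (a : Fin (∑ i, n i)) :
    flatten v a ∈ V.deg (flatten d a) := h _ _

/-- The substitution of one entry of a composition, followed by the formation of a monomial. -/
noncomputable def slotMap {k : ℕ} {n : Fin k → ℕ} (μ : P.Op k) (c : ∀ i, P.Op (n i))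
    (w : ∀ i, Fin (n i) → V) (i : Fin k) :
    P.Op (n i) →ₗ[F] MultilinearMap F (fun _ : Fin (n i) => V.carrier) (Schur ε P V) where
  toFun ν :=
    { toFun := fun v => mon (P.comp n μ (Function.update c i ν)) (flatten (Function.update w i v))
      map_update_add' := by
        intro dec v j x y
        obtain rfl : dec = instDecidableEqFin _ := Subsingleton.elim _ _
        simp only [flatten_update, MultilinearMap.map_update_add]
      map_update_smul' := by
        intro dec v j a x
        obtain rfl : dec = instDecidableEqFin _ := Subsingleton.elim _ _
        simp only [flatten_update, MultilinearMap.map_update_smul] }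
  map_add' μ ν := by ext1 x; simp
  map_smul' c μ := by ext1 x; simp

theorem exists_opS_aux {k : ℕ} (μ : P.Op k) (n : Fin k → ℕ) :
    ∃ G : MultilinearMap F (fun i => SchurSummand ε P V (n i)) (Schur ε P V),
      ∀ h : ∀ i, HomMon P V (n i), G (fun i => monS (h i).coeff (h i).vec) =
        mon (P.comp n μ fun i => (h i).coeff) (flatten fun i => (h i).vec) := by
  refine exists_multilinear_of_generators (X := fun i => HomMon P V (n i))
    (fun i h => monS h.coeff h.vec) (fun i => span_monS (n i))
    (fun h => mon (P.comp n μ fun i => (h i).coeff) (flatten fun i => (h i).vec)) ?_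
  intro i h
  refine ⟨liftS (W := Schur ε P V) (slotMap μ (fun i => (h i).coeff) (fun i => (h i).vec) i) ?_,
    fun y => ?_⟩
  · intro σ ν d x hx
    let e : ∀ j, Fin (n j) ≃ Fin (n j) := Function.update (fun j => Equiv.refl _) i σ
    have h1 : Function.update (fun i => (h i).coeff) i (P.act σ ν) =
        fun j => P.act (e j) (Function.update (fun i => (h i).coeff) i ν j) := by
      funext j
      by_cases hj : j = i
      · subst hj; simp [e]
      · simp [e, hj, P.act_refl]
    have h2 : ∀ a, flatten (Function.update (fun i => (h i).vec) i x) a ∈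
        V.deg (flatten (Function.update (fun i => (h i).degs) i d) a) := by
      refine flatten_mem _ _ fun j => ?_
      by_cases hj : j = i
      · subst hj; simpa using hx
      · simpa [hj] using (h j).vec_mem
    have h3 : ∏ j, koszulSign ε (Function.update (fun i => (h i).degs) i d j) (e j) =
        koszulSign ε d σ := by
      rw [Finset.prod_eq_single i]
      · simp [e]
      · intro j _ hj
        apply koszulSign_of_monotone
        simp [e, hj]
      · simp
    have h4 : (fun j => Function.update (fun i => (h i).vec) i x j ∘ (e j).symm) =
        Function.update (fun i => (h i).vec) i (x ∘ σ.symm) := by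
      funext j
      by_cases hj : j = i
      · subst hj; simp [e]
      · simp [e, hj]
    change mon (P.comp n μ (Function.update _ i (P.act σ ν))) (flatten (Function.update _ i x)) =
      _ • mon (P.comp n μ (Function.update _ i ν)) (flatten (Function.update _ i (x ∘ σ.symm)))
    rw [h1, P.comp_act_right, mon_act _ _ _ _ h2, koszulSign_blockSum, h3,
      flatten_comp_blockSum_symm, h4]
  · rw [liftS_monS]
    change mon (P.comp n μ (Function.update _ i _)) (flatten (Function.update _ i _)) = _
    congr 2
    · congr 1
      funext j
      by_cases hj : j = i
      · subst hj; simp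
      · simp [hj]
    · funext j
      by_cases hj : j = i
      · subst hj; simp
      · simp [hj]

theorem exists_opS {k : ℕ} (μ : P.Op k) :
    ∃ G : MultilinearMap F (fun _ : Fin k => Schur ε P V) (Schur ε P V),
      ∀ (n : Fin k → ℕ) (h : ∀ i, HomMon P V (n i)), G (fun i => mon (h i).coeff (h i).vec) =
        mon (P.comp n μ fun i => (h i).coeff) (flatten fun i => (h i).vec) := by
  choose G hG using exists_opS_aux (ε := ε) (V := V) μ
  refine ⟨MultilinearMap.fromDirectSumEquiv (R := F) (κ := fun _ : Fin k => ℕ)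
    (M := fun _ n => SchurSummand ε P V n) (M' := Schur ε P V) G, fun n h => ?_⟩
  rw [← hG n h]
  exact MultilinearMap.fromDirectSumEquiv_lof _ _ _

/-- The operation `(μ; (ν 0; x 0), ..., (ν (k - 1); x (k - 1))) ↦
(μ (ν 0, ..., ν (k - 1)); x 0, ..., x (k - 1))` on monomials, extended to `S(P, V)`. -/
noncomputable def opS {k : ℕ} :
    P.Op k →ₗ[F] MultilinearMap F (fun _ : Fin k => Schur ε P V) (Schur ε P V) where
  toFun μ := (exists_opS μ).choose
  map_add' μ ν := by
    refine multilinear_ext _ _ _ (fun _ => span_homMons) fun x hx => ?_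
    choose d n h _ hx using hx
    obtain rfl : x = fun i => mon (h i).coeff (h i).vec := funext hx
    rw [add_apply, (exists_opS μ).choose_spec, (exists_opS ν).choose_spec,
      (exists_opS (μ + ν)).choose_spec]
    simp
  map_smul' c μ := by
    refine multilinear_ext _ _ _ (fun _ => span_homMons) fun x hx => ?_
    choose d n h _ hx using hx
    obtain rfl : x = fun i => mon (h i).coeff (h i).vec := funext hx
    rw [RingHom.id_apply, smul_apply, (exists_opS μ).choose_spec,
      (exists_opS (c • μ)).choose_spec]
    simp

theorem opS_mon {k : ℕ} (μ : P.Op k) (n : Fin k → ℕ) (h : ∀ i, HomMon P V (n i)) :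
    opS (ε := ε) μ (fun i => mon (h i).coeff (h i).vec) =
      mon (P.comp n μ fun i => (h i).coeff) (flatten fun i => (h i).vec) :=
  (exists_opS μ).choose_spec n h

/-- The homogeneous monomial obtained by composition. -/
def HomMon.comp {k : ℕ} (μ : P.Op k) {n : Fin k → ℕ} (h : ∀ i, HomMon P V (n i)) :
    HomMon P V (∑ i, n i) where
  coeff := P.comp n μ fun i => (h i).coeff
  degs := flatten fun i => (h i).degs
  vec := flatten fun i => (h i).vec
  vec_mem := flatten_mem _ _ fun i => (h i).vec_mem

/-- Multilinear maps substituted into a multilinear map. -/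
def nested {M M' N : Type*} [AddCommGroup M] [AddCommGroup M'] [AddCommGroup N] [Module F M]
    [Module F M'] [Module F N] {k : ℕ} {n : Fin k → ℕ}
    (f : MultilinearMap F (fun _ : Fin k => M) N)
    (g : ∀ i, MultilinearMap F (fun _ : Fin (n i) => M') M) :
    MultilinearMap F (fun _ : Fin (∑ i, n i) => M') N :=
  have hu : ∀ (z : Fin (∑ i, n i) → M') (i : Fin k) (j : Fin (n i)) (w : M'),
      (fun i' => g i' fun j' => Function.update z (finSigmaFinEquiv ⟨i, j⟩) w
        (finSigmaFinEquiv ⟨i', j'⟩)) =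
      Function.update (fun i' => g i' fun j' => z (finSigmaFinEquiv ⟨i', j'⟩)) i
        (g i (Function.update (fun j' => z (finSigmaFinEquiv ⟨i, j'⟩)) j w)) := by
    intro z i j w
    funext i'
    by_cases hi : i' = i
    · subst hi
      rw [Function.update_self]
      congr 1
      funext j'
      by_cases hj : j' = j
      · subst hj; simp
      · simp [hj]
    · rw [Function.update_of_ne hi]
      congr 1
      funext j'
      simp [hi]
  { toFun := fun z => f fun i => g i fun j => z (finSigmaFinEquiv ⟨i, j⟩)
    map_update_add' := by
      intro dec z a x y
      obtain rfl : dec = instDecidableEqFin _ := Subsingleton.elim _ _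
      obtain ⟨⟨i, j⟩, rfl⟩ := finSigmaFinEquiv.surjective a
      rw [hu, hu, hu, (g i).map_update_add, f.map_update_add]
    map_update_smul' := by
      intro dec z a c x
      obtain rfl : dec = instDecidableEqFin _ := Subsingleton.elim _ _
      obtain ⟨⟨i, j⟩, rfl⟩ := finSigmaFinEquiv.surjective a
      rw [hu, hu, (g i).map_update_smul, f.map_update_smul] }

theorem opS_deg {n : ℕ} (μ : P.Op n) (d : Fin n → ℕ) (x : Fin n → Schur ε P V)
    (hx : ∀ i, x i ∈ Submodule.span F (homMons ε P V (d i))) :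
    opS μ x ∈ Submodule.span F (homMons ε P V (∑ i, d i)) := by
  have : ((Submodule.span F (homMons ε P V (∑ i, d i))).mkQ.compMultilinearMap (opS μ)) x = 0 := by
    refine multilinear_eq_zero _ (fun i => homMons ε P V (d i)) ?_ x hx
    intro y hy
    choose n h hd hy using hy
    obtain rfl : y = fun i => mon (h i).coeff (h i).vec := funext hy
    rw [LinearMap.compMultilinearMap_apply, Submodule.mkQ_apply, Submodule.Quotient.mk_eq_zero,
      opS_mon]
    refine Submodule.subset_span ⟨_, HomMon.comp μ h, ?_, rfl⟩
    exact (sum_flatten _).trans (Finset.sum_congr rfl fun i _ => hd i)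
  rwa [LinearMap.compMultilinearMap_apply, Submodule.mkQ_apply,
    Submodule.Quotient.mk_eq_zero] at this

theorem opS_one (x : Fin 1 → Schur ε P V) : opS P.one x = x 0 := by
  have : opS (ε := ε) (V := V) P.one =
      MultilinearMap.ofSubsingleton F (Schur ε P V) (Schur ε P V) (0 : Fin 1) LinearMap.id := by
    refine multilinear_ext _ _ _ (fun _ => span_homMons) fun x hx => ?_
    obtain ⟨d, n, h, _, hx⟩ := hx 0
    obtain rfl : x = fun _ => mon h.coeff h.vec := by
      funext i
      rw [Subsingleton.elim i 0, hx]
    rw [opS_mon P.one (fun _ => n) (fun _ => h), P.one_comp, mon_finCongr]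
    change _ = mon h.coeff h.vec
    congr 1
    funext j
    have hj : (finCongr (by simp : ∑ _ : Fin 1, n = n)).symm j =
        finSigmaFinEquiv (n := fun _ : Fin 1 => n) ⟨0, j⟩ := by
      apply Fin.ext
      rw [finSigmaFinEquiv_one]
      simp
    rw [Function.comp_apply, hj, flatten_apply]
  rw [this]
  rfl

theorem opS_act {m n : ℕ} (e : Fin m ≃ Fin n) (μ : P.Op n) (d : Fin m → ℕ)
    (x : Fin m → Schur ε P V) (hx : ∀ i, x i ∈ Submodule.span F (homMons ε P V (d i))) :
    opS (P.act e μ) x = koszulSign ε d e • opS μ (x ∘ e.symm) := by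
  have : ((opS (P.act e μ) - ((koszulSign ε d e : ℤˣ) : ℤ) •
      (opS (ε := ε) (V := V) μ).domDomCongr e.symm :
        MultilinearMap F (fun _ : Fin m => Schur ε P V) (Schur ε P V))) x = 0 := by
    refine multilinear_eq_zero _ (fun i => homMons ε P V (d i)) ?_ x hx
    intro y hy
    have hy' : ∀ j, y (e.symm j) ∈ homMons ε P V (d (e.symm j)) := fun j => hy _
    choose N h hd hy' using hy'
    have h1 : y = fun i => mon (h (e i)).coeff (h (e i)).vec := by
      funext i
      rw [← hy', e.symm_apply_apply]
    have h2 : (fun j => y (e.symm j)) = fun j => mon (h j).coeff (h j).vec := funext hy'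
    rw [sub_apply, smul_apply, MultilinearMap.domDomCongr_apply, h2,
      opS_mon, sub_eq_zero, h1, opS_mon (P.act e μ) (fun i => N (e i)) (fun i => h (e i)),
      P.comp_act_left e N μ fun j => (h j).coeff,
      mon_act _ _ (flatten fun i => (h (e i)).degs) _ (flatten_mem _ _ fun i => (h (e i)).vec_mem),
      koszulSign_blockPerm, flatten_comp_blockPerm_symm e N fun j => (h j).vec]
    have h3 : (fun i => ∑ a, (h (e i)).degs a) = d := by
      funext i
      rw [hd, e.symm_apply_apply]
    rw [h3, Units.smul_def]
  rw [sub_apply, smul_apply, MultilinearMap.domDomCongr_apply,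
    sub_eq_zero] at this
  exact this

theorem opS_comp {k : ℕ} (n : Fin k → ℕ) (μ : P.Op k) (ν : ∀ i, P.Op (n i))
    (x : ∀ i, Fin (n i) → Schur ε P V) :
    opS (P.comp n μ ν) (flatten x) = opS μ (fun i => opS (ν i) (x i)) := by
  have : opS (P.comp n μ ν) = nested (opS (ε := ε) (V := V) μ) fun i => opS (ν i) := by
    refine multilinear_ext _ _ _ (fun _ => span_homMons) fun x hx => ?_
    choose d N h _ hx using hx
    obtain rfl : x = fun a => mon (h a).coeff (h a).vec := funext hx
    change _ = opS μ fun i => opS (ν i) fun j => mon (h (finSigmaFinEquiv ⟨i, j⟩)).coeff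
      (h (finSigmaFinEquiv ⟨i, j⟩)).vec
    have h1 : ∀ i, opS (ν i) (fun j => mon (h (finSigmaFinEquiv ⟨i, j⟩)).coeff
        (h (finSigmaFinEquiv ⟨i, j⟩)).vec) = mon (ε := ε)
        (HomMon.comp (ν i) fun j => h (finSigmaFinEquiv ⟨i, j⟩)).coeff
        (HomMon.comp (ν i) fun j => h (finSigmaFinEquiv ⟨i, j⟩)).vec := fun i => opS_mon _ _ _
    simp only [h1]
    rw [opS_mon μ _ fun i => HomMon.comp (ν i) fun j => h (finSigmaFinEquiv ⟨i, j⟩), opS_mon,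
      P.assoc, mon_finCongr]
    change mon _ _ = mon _ _
    congr 1
    rw [← Function.Surjective.right_cancellable (finCongr (sum_finSigma n N)).surjective]
    funext a
    revert a
    rw [forall_flat, forall_flat]
    intro i j l
    have h2 : finCongr (sum_finSigma n N) (finSigmaFinEquiv ⟨finSigmaFinEquiv ⟨i, j⟩, l⟩) =
        finSigmaFinEquiv (n := fun i => ∑ j, N (finSigmaFinEquiv ⟨i, j⟩))
        ⟨i, finSigmaFinEquiv (n := fun j => N (finSigmaFinEquiv ⟨i, j⟩)) ⟨j, l⟩⟩ :=
      Fin.ext (finSigma_assoc i j l)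
    simp only [Function.comp_apply, Equiv.symm_apply_apply]
    rw [h2, flatten_apply, flatten_apply]
    exact (flatten_apply (fun j => (h (finSigmaFinEquiv ⟨i, j⟩)).vec) j l).symm
  rw [this]
  change opS μ (fun i => opS (ν i) fun j => flatten x (finSigmaFinEquiv ⟨i, j⟩)) = _
  simp only [flatten_apply]

variable (ε P V) in
/-- The free graded `P`-algebra `S(P, V)`. -/
noncomputable def freeAlgebra : PAlgebra.{w, u, max u v w} ε P where
  toGradedSpace := schurSpace ε P V
  op := opS
  op_deg := opS_deg
  op_one := opS_one
  op_act := opS_act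
  op_comp := opS_comp

end Schur

section Quotient

variable {F : Type w} [Field F] {ε : ℤˣ} {P : Operad.{w, u} F} (A : PAlgebra.{w, u, v} ε P)

/-- Graded `P`-ideals of a graded `P`-algebra: graded subspaces which contain `μ (x 0, ..., x (n - 1))`
whenever they contain one of the inputs (by symmetry, it does not matter which one). -/
structure PAlgebra.IsIdeal (I : Submodule F A.carrier) : Prop where
  homogeneous : ∀ (d : ℕ) (x : A.carrier), x ∈ I → A.proj d x ∈ I
  op_mem : ∀ {n : ℕ} (μ : P.Op n) (x : Fin n → A.carrier) (i : Fin n), x i ∈ I → A.op μ x ∈ I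

/-- The graded `P`-ideal generated by a subset. -/
def PAlgebra.idealSpan (X : Set A.carrier) : Submodule F A.carrier :=
  sInf {I | A.IsIdeal I ∧ X ⊆ I}

theorem PAlgebra.isIdeal_idealSpan (X : Set A.carrier) : A.IsIdeal (A.idealSpan X) where
  homogeneous d x hx := by
    simp only [idealSpan, Submodule.mem_sInf] at hx ⊢
    exact fun I hI => hI.1.homogeneous d x (hx I hI)
  op_mem μ x i hx := by
    simp only [idealSpan, Submodule.mem_sInf] at hx ⊢
    exact fun I hI => hI.1.op_mem μ x i (hx I hI)

theorem PAlgebra.subset_idealSpan (X : Set A.carrier) : X ⊆ A.idealSpan X := by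
  intro x hx
  simp only [idealSpan, SetLike.mem_coe, Submodule.mem_sInf]
  exact fun I hI => hI.2 hx

theorem PAlgebra.idealSpan_le {X : Set A.carrier} {I : Submodule F A.carrier} (hI : A.IsIdeal I)
    (h : X ⊆ I) : A.idealSpan X ≤ I := sInf_le ⟨hI, h⟩

variable {A} {I : Submodule F A.carrier}

theorem PAlgebra.IsIdeal.exists_op (hI : A.IsIdeal I) {n : ℕ} (μ : P.Op n) :
    ∃ G : MultilinearMap F (fun _ : Fin n => A.carrier ⧸ I) (A.carrier ⧸ I),
      ∀ x, G (fun i => I.mkQ (x i)) = I.mkQ (A.op μ x) :=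
  exists_multilinear_of_surjective (fun _ => I.mkQ) (fun _ => I.mkQ_surjective)
    (I.mkQ.compMultilinearMap (A.op μ)) fun i x hx => by
      rw [Submodule.mkQ_apply, Submodule.Quotient.mk_eq_zero] at hx
      rw [LinearMap.compMultilinearMap_apply, Submodule.mkQ_apply, Submodule.Quotient.mk_eq_zero]
      exact hI.op_mem μ x i hx

theorem exists_lifts {n : ℕ} (x : Fin n → A.carrier ⧸ I) :
    ∃ y : Fin n → A.carrier, x = fun i => I.mkQ (y i) := by
  choose y hy using fun i => I.mkQ_surjective (x i)
  exact ⟨y, funext fun i => (hy i).symm⟩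

/-- The operations of a quotient by an ideal. -/
noncomputable def PAlgebra.IsIdeal.op (hI : A.IsIdeal I) {n : ℕ} :
    P.Op n →ₗ[F] MultilinearMap F (fun _ : Fin n => A.carrier ⧸ I) (A.carrier ⧸ I) where
  toFun μ := (hI.exists_op μ).choose
  map_add' μ ν := by
    ext x
    obtain ⟨y, rfl⟩ := exists_lifts x
    rw [add_apply, (hI.exists_op μ).choose_spec, (hI.exists_op ν).choose_spec,
      (hI.exists_op (μ + ν)).choose_spec]
    simp
  map_smul' c μ := by
    ext x
    obtain ⟨y, rfl⟩ := exists_lifts x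
    rw [RingHom.id_apply, smul_apply, (hI.exists_op μ).choose_spec,
      (hI.exists_op (c • μ)).choose_spec]
    simp

theorem PAlgebra.IsIdeal.op_mkQ (hI : A.IsIdeal I) {n : ℕ} (μ : P.Op n) (x : Fin n → A.carrier) :
    hI.op μ (fun i => I.mkQ (x i)) = I.mkQ (A.op μ x) := (hI.exists_op μ).choose_spec x

/-- The quotient of a graded `P`-algebra by a graded `P`-ideal. -/
noncomputable def PAlgebra.quotient (A : PAlgebra.{w, u, v} ε P) (I : Submodule F A.carrier)
    (hI : A.IsIdeal I) : PAlgebra.{w, u, v} ε P where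
  carrier := A.carrier ⧸ I
  deg d := (A.deg d).map I.mkQ
  isInternal := by
    refine GradedSpace.isInternal_of_proj _
      (fun d => I.mapQ I (A.proj d) fun x hx => hI.homogeneous d x hx) ?_ ?_
    · rintro d i _ ⟨x, hx, rfl⟩
      rw [Submodule.mkQ_apply, Submodule.mapQ_apply, A.proj_of_mem d hx]
      split_ifs <;> simp
    · rw [← Submodule.map_iSup, A.isInternal.submodule_iSup_eq_top, Submodule.map_top,
        Submodule.range_mkQ]
  op := hI.op
  op_deg := by
    intro n μ d x hx
    choose y hy hxy using hx
    obtain rfl : (fun i => I.mkQ (y i)) = x := funext hxy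
    rw [hI.op_mkQ]
    exact Submodule.mem_map_of_mem (A.op_deg μ d y hy)
  op_one := by
    intro x
    obtain ⟨y, rfl⟩ := exists_lifts x
    rw [hI.op_mkQ, A.op_one]
  op_act := by
    intro m n e μ d x hx
    choose y hy hxy using hx
    obtain rfl : (fun i => I.mkQ (y i)) = x := funext hxy
    have := hI.op_mkQ μ (y ∘ e.symm)
    rw [hI.op_mkQ, A.op_act e μ d y hy, Units.smul_def, map_zsmul, ← this]
    rfl
  op_comp := by
    intro k n μ ν x
    choose y hy using fun i => exists_lifts (x i)
    obtain rfl : x = fun i j => I.mkQ (y i j) := funext hy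
    have h1 : flatten (fun i j => I.mkQ (y i j)) = fun a => I.mkQ (flatten y a) := rfl
    rw [h1, hI.op_mkQ, A.op_comp]
    simp only [hI.op_mkQ]

end Quotient

section Frobenius

variable (p : ℕ) [Fact p.Prime]

/-- An `ℕ`-graded `𝔽_p`-vector space with a Frobenius map: a linear endomorphism which multiplies
degrees by `p`. -/
structure FrobSpace extends GradedSpace.{0, v} (ZMod p) where
  frob : carrier →ₗ[ZMod p] carrier
  frob_deg : ∀ (d : ℕ) (x : carrier), x ∈ deg d → frob x ∈ deg (p * d)

variable {p}

/-- A `P`-algebra in the category of graded vector spaces with Frobenius map, where the Frobenius of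
`P` is the identity. -/
structure FrobPAlgebra (ε : ℤˣ) (P : Operad.{0, u} (ZMod p)) extends PAlgebra.{0, u, v} ε P,
    FrobSpace.{v} p where
  frob_op : ∀ {n : ℕ} (μ : P.Op n) (x : Fin n → carrier),
    frob (op μ x) = op μ (fun i => frob (x i))

/-- The Frobenius map of `A` is adapted to `star` if `x^[p] = star (x, ..., x)` for all `x`. -/
def FrobPAlgebra.IsAdapted {ε : ℤˣ} {P : Operad.{0, u} (ZMod p)} (A : FrobPAlgebra.{u, v} ε P)
    (star : P.Op p) : Prop :=
  ∀ x : A.carrier, A.frob x = A.op star (fun _ => x)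

section FreeFrob

variable (V : GradedSpace.{0, v} (ZMod p))

/-- The degree `n` part of `Fr(V)`: spanned by the elements `x^[p^k]` with `x` homogeneous and
`p ^ k * |x| = n`. -/
noncomputable def freeFrobDeg (n : ℕ) : Submodule (ZMod p) (ℕ →₀ V.carrier) :=
  Submodule.span (ZMod p)
    {z | ∃ (k i : ℕ) (x : V.carrier), p ^ k * i = n ∧ x ∈ V.deg i ∧ z = Finsupp.single k x}

/-- The projection of `Fr(V)` onto its degree `n` part. -/
noncomputable def freeFrobProj (n : ℕ) : (ℕ →₀ V.carrier) →ₗ[ZMod p] (ℕ →₀ V.carrier) :=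
  Finsupp.lsum (ZMod p) fun k =>
    if p ^ k ∣ n then Finsupp.lsingle k ∘ₗ V.proj (n / p ^ k) else 0

theorem freeFrobProj_of_mem (n i : ℕ) (z : ℕ →₀ V.carrier) (hz : z ∈ freeFrobDeg V i) :
    freeFrobProj V n z = if n = i then z else 0 := by
  have hp : 0 < p := (Fact.out : p.Prime).pos
  induction hz using Submodule.span_induction with
  | mem z hz =>
    obtain ⟨k, i, x, rfl, hx, rfl⟩ := hz
    have hpk : 0 < p ^ k := pow_pos hp k
    rw [freeFrobProj, Finsupp.lsum_single]
    by_cases hn : p ^ k ∣ n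
    · obtain ⟨m, rfl⟩ := hn
      rw [if_pos (dvd_mul_right _ _), LinearMap.comp_apply, Nat.mul_div_cancel_left _ hpk,
        V.proj_of_mem m hx]
      by_cases hm : m = i
      · simp [hm]
      · have : p ^ k * m ≠ p ^ k * i := fun h => hm (Nat.eq_of_mul_eq_mul_left hpk h)
        rw [if_neg hm, if_neg this, map_zero]
    · have : n ≠ p ^ k * i := fun h => hn ⟨i, h⟩
      rw [if_neg hn, if_neg this, LinearMap.zero_apply]
  | zero => simp
  | add x y _ _ h1 h2 => rw [map_add, h1, h2]; split_ifs <;> simp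
  | smul c x _ h1 => rw [map_smul, h1]; split_ifs <;> simp

/-- The free graded vector space with Frobenius map `Fr(V)`: the direct sum of the `V^[p^k]`, `k ≥ 0`,
where `Finsupp.single k x` stands for `x^[p^k]`. -/
noncomputable def freeFrob : FrobSpace.{v} p where
  carrier := ℕ →₀ V.carrier
  deg := freeFrobDeg V
  isInternal := by
    refine GradedSpace.isInternal_of_proj _ (freeFrobProj V) (freeFrobProj_of_mem V) ?_
    rw [eq_top_iff]
    rintro z -
    induction z using Finsupp.induction_linear with
    | zero => exact zero_mem _
    | add x y hx hy => exact add_mem hx hy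
    | single k x =>
      have hx : x ∈ Submodule.span (ZMod p) {x : V.carrier | ∃ d, x ∈ V.deg d} := by
        rw [V.span_homogeneous]; trivial
      have := Submodule.mem_map_of_mem (f := Finsupp.lsingle (R := ZMod p) k) hx
      rw [Submodule.map_span] at this
      refine Submodule.span_le.2 ?_ this
      rintro _ ⟨y, ⟨d, hy⟩, rfl⟩
      exact Submodule.mem_iSup_of_mem (p ^ k * d) (Submodule.subset_span ⟨k, d, y, rfl, hy, rfl⟩)
  frob := Finsupp.lmapDomain V.carrier (ZMod p) Nat.succ
  frob_deg := by
    intro d z hz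
    have := Submodule.mem_map_of_mem (f := Finsupp.lmapDomain V.carrier (ZMod p) Nat.succ) hz
    rw [freeFrobDeg, Submodule.map_span] at this
    refine Submodule.span_mono ?_ this
    rintro _ ⟨_, ⟨k, i, x, rfl, hx, rfl⟩, rfl⟩
    refine ⟨k + 1, i, x, by ring, hx, ?_⟩
    rw [Finsupp.lmapDomain_apply, Finsupp.mapDomain_single]

end FreeFrob

theorem koszulSign_smul {ε : ℤˣ} {m n : ℕ} (d : Fin m → ℕ) (e : Fin m ≃ Fin n)
    {W : Type*} [AddCommGroup W] [Module (ZMod p) W] (z : W) :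
    koszulSign ε (fun i => p * d i) e • z = koszulSign ε d e • z := by
  rcases (Fact.out : p.Prime).eq_two_or_odd' with rfl | hodd
  · have h2 : ∀ u : ℤˣ, u • z = z := by
      intro u
      rcases Int.units_eq_one_or u with rfl | rfl
      · simp
      · have : (2 : ZMod 2) • z = 0 := by
          rw [show (2 : ZMod 2) = 0 from rfl, zero_smul]
        rw [two_smul] at this
        rw [Units.neg_smul, one_smul, neg_eq_iff_add_eq_zero, this]
    rw [h2, h2]
  · have : koszulSign ε (fun i => p * d i) e = koszulSign ε d e := by
      unfold koszulSign
      refine Finset.prod_congr rfl fun i _ => Finset.prod_congr rfl fun j _ => ?_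
      have h : p * d i * (p * d j) = d i * d j * (p * p) := by ring
      rw [h, pow_mul]
      congr 1
      rcases Int.units_eq_one_or (ε ^ (d i * d j)) with h | h
      · rw [h, one_pow]
      · rw [h, (hodd.mul hodd).neg_one_pow]
    rw [this]

section FreeFrobAlgebra

variable (ε : ℤˣ) (P : Operad.{0, u} (ZMod p)) (M : FrobSpace.{v} p)

/-- The maps `(μ, x) ↦ (μ; φ (x 0), ..., φ (x (n - 1)))`. -/
noncomputable def frobFam (n : ℕ) : P.Op n →ₗ[ZMod p]
    MultilinearMap (ZMod p) (fun _ : Fin n => M.carrier) (Schur ε P M.toGradedSpace) where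
  toFun μ := (mon μ).compLinearMap fun _ => M.frob
  map_add' μ ν := by ext1 x; simp
  map_smul' c μ := by ext1 x; simp

/-- The Frobenius map of `S(P, M)`, which sends `(μ; x 0, ..., x (n - 1))` to
`(μ; φ (x 0), ..., φ (x (n - 1)))`. -/
noncomputable def schurFrob :
    Schur ε P M.toGradedSpace →ₗ[ZMod p] Schur ε P M.toGradedSpace :=
  lift (W := Schur ε P M.toGradedSpace) (frobFam ε P M) <| by
    intro n σ μ d x hx
    change mon (P.act σ μ) (fun i => M.frob (x i)) =
      _ • mon μ (fun i => M.frob ((x ∘ σ.symm) i))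
    rw [mon_act σ μ (fun i => p * d i) _ fun i => M.frob_deg _ _ (hx i), koszulSign_smul]
    rfl

theorem schurFrob_mon {n : ℕ} (μ : P.Op n) (x : Fin n → M.carrier) :
    schurFrob ε P M (mon μ x) = mon μ (fun i => M.frob (x i)) := lift_mon _ _ _ _

/-- The Frobenius of a homogeneous monomial. -/
def frobMon {n : ℕ} (h : HomMon P M.toGradedSpace n) : HomMon P M.toGradedSpace n where
  coeff := h.coeff
  degs i := p * h.degs i
  vec i := M.frob (h.vec i)
  vec_mem i := M.frob_deg _ _ (h.vec_mem i)

theorem schurFrob_opS {k : ℕ} (μ : P.Op k) (x : Fin k → Schur ε P M.toGradedSpace) :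
    schurFrob ε P M (opS μ x) = opS μ (fun i => schurFrob ε P M (x i)) := by
  have : (schurFrob ε P M).compMultilinearMap (opS μ) =
      (opS μ).compLinearMap fun _ => schurFrob ε P M := by
    refine multilinear_ext _ _ _ (fun _ => span_homMons) fun x hx => ?_
    choose d n h _ hx using hx
    obtain rfl : x = fun i => mon (h i).coeff (h i).vec := funext hx
    rw [LinearMap.compMultilinearMap_apply, opS_mon, schurFrob_mon,
      MultilinearMap.compLinearMap_apply]
    simp only [schurFrob_mon]
    exact (opS_mon μ n fun i => frobMon P M (h i)).symm
  exact congrArg (fun f => f x) this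

theorem schurFrob_deg (d : ℕ) (z : Schur ε P M.toGradedSpace)
    (hz : z ∈ Submodule.span (ZMod p) (homMons ε P M.toGradedSpace d)) :
    schurFrob ε P M z ∈ Submodule.span (ZMod p) (homMons ε P M.toGradedSpace (p * d)) := by
  have := Submodule.mem_map_of_mem (f := schurFrob ε P M) hz
  rw [Submodule.map_span] at this
  refine Submodule.span_mono ?_ this
  rintro _ ⟨_, ⟨n, h, rfl, rfl⟩, rfl⟩
  refine ⟨n, frobMon P M h, ?_, schurFrob_mon ε P M _ _⟩
  exact (Finset.mul_sum _ _ _).symm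

/-- The free `P`-algebra `S(P, M)` in graded vector spaces with Frobenius map. -/
noncomputable def freeFrobAlgebra : FrobPAlgebra.{u, max u v} ε P where
  toPAlgebra := freeAlgebra ε P M.toGradedSpace
  frob := schurFrob ε P M
  frob_deg := schurFrob_deg ε P M
  frob_op := schurFrob_opS ε P M

end FreeFrobAlgebra

section Adapted

variable {ε : ℤˣ} {P : Operad.{0, u} (ZMod p)}

theorem FrobPAlgebra.frob_proj (A : FrobPAlgebra.{u, v} ε P) (d : ℕ) (x : A.carrier) :
    A.proj (p * d) (A.frob x) = A.frob (A.proj d x) := by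
  have h : A.proj (p * d) ∘ₗ A.frob = A.frob ∘ₗ A.proj d := by
    refine LinearMap.ext_on A.span_homogeneous ?_
    rintro x ⟨i, hx⟩
    rw [LinearMap.comp_apply, LinearMap.comp_apply, A.proj_of_mem _ (A.frob_deg i x hx),
      A.proj_of_mem _ hx]
    have hp : 0 < p := (Fact.out : p.Prime).pos
    by_cases hd : d = i
    · simp [hd]
    · have : p * d ≠ p * i := fun h => hd (Nat.eq_of_mul_eq_mul_left hp h)
      rw [if_neg hd, if_neg this, map_zero]
  exact congrArg (fun f => f x) h

/-- The set of all `t^[p] - star (t, ..., t)`. -/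
def FrobPAlgebra.adaptedRel (A : FrobPAlgebra.{u, v} ε P) (star : P.Op p) : Set A.carrier :=
  {z | ∃ t : A.carrier, z = A.frob t - A.op star (fun _ => t)}

/-- The ideal generated by the `t^[p] - star (t, ..., t)` is stable under the Frobenius map. -/
theorem FrobPAlgebra.frob_idealSpan (A : FrobPAlgebra.{u, v} ε P) (star : P.Op p) :
    A.idealSpan (A.adaptedRel star) ≤ (A.idealSpan (A.adaptedRel star)).comap A.frob := by
  have hI := A.isIdeal_idealSpan (A.adaptedRel star)
  refine A.idealSpan_le ⟨?_, ?_⟩ ?_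
  · intro d x hx
    rw [Submodule.mem_comap] at hx ⊢
    rw [← A.frob_proj]
    exact hI.homogeneous _ _ hx
  · intro n μ x i hx
    rw [Submodule.mem_comap] at hx ⊢
    rw [A.frob_op]
    exact hI.op_mem μ _ i hx
  · rintro _ ⟨t, rfl⟩
    apply A.subset_idealSpan
    exact ⟨A.frob t, by rw [map_sub, A.frob_op]⟩

/-- The quotient of a `P`-algebra with Frobenius map by a `P`-ideal stable under the Frobenius. -/
noncomputable def FrobPAlgebra.quotientFrob (A : FrobPAlgebra.{u, v} ε P)
    (I : Submodule (ZMod p) A.carrier) (hI : A.IsIdeal I) (hF : I ≤ I.comap A.frob) :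
    FrobPAlgebra.{u, v} ε P where
  toPAlgebra := A.toPAlgebra.quotient I hI
  frob := I.mapQ I A.frob hF
  frob_deg := by
    rintro d _ ⟨x, hx, rfl⟩
    exact Submodule.mem_map_of_mem (f := I.mkQ) (A.frob_deg d x hx)
  frob_op := by
    intro n μ x
    obtain ⟨y, rfl⟩ := exists_lifts (A := A.toPAlgebra) x
    change I.mapQ I A.frob hF (hI.op μ _) = hI.op μ (fun i => I.mkQ (A.frob (y i)))
    rw [hI.op_mkQ, hI.op_mkQ, Submodule.mkQ_apply, Submodule.mapQ_apply, A.frob_op,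
      Submodule.mkQ_apply]

variable (ε P) in
/-- The free `P`-algebra with `star`-adapted Frobenius generated by `M`: the quotient of `S(P, M)` by
the `P`-ideal generated by the elements `t^[p] - star (t, ..., t)`. -/
noncomputable def freeAdapted (star : P.Op p) (M : FrobSpace.{v} p) :
    FrobPAlgebra.{u, max u v} ε P :=
  (freeFrobAlgebra ε P M).quotientFrob
    ((freeFrobAlgebra ε P M).idealSpan ((freeFrobAlgebra ε P M).adaptedRel star))
    ((freeFrobAlgebra ε P M).isIdeal_idealSpan _) ((freeFrobAlgebra ε P M).frob_idealSpan star)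

theorem freeAdapted_isAdapted (star : P.Op p) (M : FrobSpace.{v} p) :
    (freeAdapted ε P star M).IsAdapted star := by
  intro x
  have hI := (freeFrobAlgebra ε P M).isIdeal_idealSpan ((freeFrobAlgebra ε P M).adaptedRel star)
  obtain ⟨y, rfl⟩ := Submodule.mkQ_surjective _ x
  change Submodule.mapQ _ _ (freeFrobAlgebra ε P M).frob
    ((freeFrobAlgebra ε P M).frob_idealSpan star) _ = hI.op star _
  rw [hI.op_mkQ, Submodule.mkQ_apply, Submodule.mapQ_apply, Submodule.mkQ_apply,
    Submodule.Quotient.eq]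
  exact (freeFrobAlgebra ε P M).subset_idealSpan _ ⟨y, rfl⟩

end Adapted

end Frobenius

end OperadFrob

-- In every graded `P`-algebra `A` the map `x ↦ star (x, ..., x)` is already a Frobenius map. It is
-- additive because the expansion of `star (x + y, ..., x + y)` runs over the subsets of the `p`
-- inputs, symmetry makes a term depend only on the size `k` of the subset, and `p` divides the
-- binomial coefficient for `0 < k < p`. It is homogeneous because `c ^ p = c` in `𝔽_p`, and it
-- commutes with all operations by centrality.
--
-- Koszul signs matter only for `ε = -1` and `p` odd. Then exchanging two equal odd inputs shows
-- that `star` vanishes on them, so odd elements have zero `star`-power. The terms that survive in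
-- the expansion, and the cases of the interchange relation in which both sides can be nonzero,
-- involve no sign. These facts are `PAlgebra.pow_add` and `PAlgebra.powMap_op`.
--
-- Consequently a morphism from the free algebra with adapted Frobenius on `M` to a `P`-algebra `A`
-- is the same as a degree-preserving linear map `M → A` that turns the Frobenius of `M` into the
-- `star`-power of `A` (`exists_freeAdapted_hom`, `freeAdapted_hom_ext`). For `M = Fr(V)` such a map
-- is the same as a degree-preserving linear map `V → A` (`exists_freeFrob_hom`, `freeFrob_ext`),
-- which is in turn the same as a morphism `S(P, V) → A`. Both algebras thus have the same universal
-- property; the two morphisms that it provides are inverse to each other, since their composites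
-- fix the generators.

universe v'

namespace OperadFrob

/-! ### The universal property of the free algebra `S(P, V)`. -/

section FreeProperty

variable {F : Type w} [Field F] {ε : ℤˣ} {P : Operad.{w, u} F} {V : GradedSpace.{w, v} F}

/-- The maps `(μ, x) ↦ μ (g (x 0), ..., g (x (n - 1)))`. -/
noncomputable def PAlgebra.opFam (A : PAlgebra.{w, u, v'} ε P) (g : V.carrier →ₗ[F] A.carrier)
    (n : ℕ) : P.Op n →ₗ[F] MultilinearMap F (fun _ : Fin n => V.carrier) A.carrier where
  toFun μ := (A.op μ).compLinearMap fun _ => g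
  map_add' μ ν := by ext1 x; simp
  map_smul' c μ := by ext1 x; simp

/-- The universal property of the free algebra `S(P, V)`: the extension of a linear map of degree
zero to a morphism of `P`-algebras. -/
noncomputable def freeLift (A : PAlgebra.{w, u, v'} ε P) (g : V.carrier →ₗ[F] A.carrier)
    (hg : ∀ d x, x ∈ V.deg d → g x ∈ A.deg d) : Schur ε P V →ₗ[F] A.carrier :=
  lift (A.opFam g) fun _ σ μ d _ hx => A.op_act σ μ d _ fun i => hg _ _ (hx i)

variable (A : PAlgebra.{w, u, v'} ε P) (g : V.carrier →ₗ[F] A.carrier)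
    (hg : ∀ d x, x ∈ V.deg d → g x ∈ A.deg d)

theorem freeLift_mon {n : ℕ} (μ : P.Op n) (x : Fin n → V) :
    freeLift A g hg (mon μ x) = A.op μ fun i => g (x i) := lift_mon _ _ _ _

/-- By multilinearity it suffices to insert homogeneous monomials. There the operations of `S(P, V)`
are composition in `P` followed by concatenation, which `A.op_comp` evaluates in `A`. -/
theorem freeLift_op {k : ℕ} (μ : P.Op k) (x : Fin k → Schur ε P V) :
    freeLift A g hg (opS μ x) = A.op μ fun i => freeLift A g hg (x i) := by
  have : (freeLift A g hg).compMultilinearMap (opS μ) =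
      (A.op μ).compLinearMap fun _ => freeLift A g hg := by
    refine multilinear_ext _ _ _ (fun _ => span_homMons) fun x hx => ?_
    choose d n h _ hx using hx
    obtain rfl : x = fun i => mon (h i).coeff (h i).vec := funext hx
    rw [LinearMap.compMultilinearMap_apply, opS_mon, freeLift_mon,
      MultilinearMap.compLinearMap_apply]
    simp only [freeLift_mon]
    rw [← A.op_comp]
    rfl
  exact congrArg (fun f => f x) this

theorem freeLift_deg (d : ℕ) (x : Schur ε P V)
    (hx : x ∈ Submodule.span F (homMons ε P V d)) : freeLift A g hg x ∈ A.deg d := by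
  have h : Submodule.span F (homMons ε P V d) ≤ (A.deg d).comap (freeLift A g hg) := by
    rw [Submodule.span_le]
    rintro _ ⟨n, h, rfl, rfl⟩
    rw [SetLike.mem_coe, Submodule.mem_comap, freeLift_mon]
    exact A.op_deg _ _ _ fun i => hg _ _ (h.vec_mem i)
  exact h hx

variable (ε P V) in
/-- The inclusion of the generators in `S(P, V)`. -/
noncomputable def freeGen : V.carrier →ₗ[F] Schur ε P V :=
  (MultilinearMap.ofSubsingleton F V.carrier (Schur ε P V) (0 : Fin 1)).symm (mon P.one)

theorem freeGen_apply (x : V) : freeGen ε P V x = mon P.one fun _ => x := rfl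

theorem freeGen_deg (d : ℕ) (x : V) (hx : x ∈ V.deg d) :
    freeGen ε P V x ∈ Submodule.span F (homMons ε P V d) :=
  Submodule.subset_span ⟨1, ⟨P.one, fun _ => d, fun _ => x, fun _ => hx⟩, by simp, rfl⟩

theorem freeLift_freeGen (x : V) : freeLift A g hg (freeGen ε P V x) = g x := by
  rw [freeGen_apply, freeLift_mon, A.op_one]

/-- This is the right unit law of the operad, up to the reindexing of `n` blocks of size one. It
shows that `V` generates `S(P, V)`. -/
theorem opS_freeGen {n : ℕ} (μ : P.Op n) (x : Fin n → V) :
    opS μ (fun i => freeGen ε P V (x i)) = mon μ x := by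
  have : (opS μ).compLinearMap (fun _ => freeGen ε P V) = mon μ := by
    refine multilinear_ext _ _ _ (fun _ => V.span_homogeneous) fun x hx => ?_
    choose d hx using hx
    rw [MultilinearMap.compLinearMap_apply]
    refine (opS_mon μ (fun _ => 1) fun i =>
      ⟨P.one, fun _ => d i, fun _ => x i, fun _ => hx i⟩).trans ?_
    rw [P.comp_one, mon_finCongr]
    congr 1
    rw [← Function.Surjective.right_cancellable
      (finCongr (by simp : ∑ _ : Fin n, 1 = n)).surjective]
    funext a
    revert a
    rw [forall_flat]
    intro i j
    simp only [Function.comp_apply, Equiv.symm_apply_apply]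
    rw [flatten_apply]
    congr 1
    apply Fin.ext
    -- The only element of block `i` comes after `i` blocks of size one, so its position is `i`.
    have := finSigma_val (n := fun _ : Fin n => 1) i j
    obtain rfl : j = 0 := Subsingleton.elim _ _
    simp only [finCongr_apply, Fin.val_cast]
    rw [this, ← Finset.sum_filter, Finset.filter_gt_eq_Iio]
    simp
  exact congrArg (fun f => f x) this

end FreeProperty

/-! ### Additivity of `p`-th powers in characteristic `p`. -/

section Power

variable {p : ℕ} [Fact p.Prime]

/-- Grouping the multilinear expansion by the size `k` of the set of inputs equal to `x` gives
binomial coefficients, which are divisible by `p` for `0 < k < p`. The hypothesis asks for no more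
than invariance on these particular inputs, so that it can also be verified when `f` is symmetric
only up to Koszul signs. -/
theorem add_pow_of_card {M N : Type*} [AddCommGroup M] [AddCommGroup N] [Module (ZMod p) M]
    [Module (ZMod p) N] (f : MultilinearMap (ZMod p) (fun _ : Fin p => M) N) (x y : M)
    (h : ∀ s t : Finset (Fin p), s.card = t.card →
      f (s.piecewise (fun _ => x) fun _ => y) = f (t.piecewise (fun _ => x) fun _ => y)) :
    f (fun _ => x + y) = f (fun _ => x) + f (fun _ => y) := by
  have hp : p.Prime := Fact.out
  have h1 : ∀ k, ∃ z : N, ∀ s : Finset (Fin p), s.card = k →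
      f (s.piecewise (fun _ => x) fun _ => y) = z := by
    intro k
    by_cases hk : ∃ s : Finset (Fin p), s.card = k
    · obtain ⟨s, hs⟩ := hk
      exact ⟨_, fun t ht => h t s (ht.trans hs.symm)⟩
    -- No subset has size `k > p`, and the value chosen there is irrelevant.
    · exact ⟨0, fun s hs => (hk ⟨s, hs⟩).elim⟩
  choose z hz using h1
  have h2 := f.map_add_univ (fun _ => x) fun _ => y
  have h3 : (fun _ : Fin p => x + y) = (fun _ => x) + fun _ => y := rfl
  rw [h3, h2, Finset.sum_congr rfl fun s _ => hz s.card s rfl, ← Finset.powerset_univ,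
    Finset.sum_powerset_apply_card, Finset.card_univ, Fintype.card_fin, Finset.sum_range_succ,
    Nat.choose_self, one_smul, Finset.sum_eq_single_of_mem 0 (by simp [hp.pos]),
    Nat.choose_zero_right, one_smul, ← hz 0 ∅ rfl, ← hz p Finset.univ (by simp)]
  · simp [add_comm]
  · intro k hk hk0
    rw [← Nat.cast_smul_eq_nsmul (ZMod p),
      (ZMod.natCast_eq_zero_iff _ _).2 (hp.dvd_choose_self hk0 (Finset.mem_range.1 hk)), zero_smul]

end Power

/-! ### Koszul signs and parity of degrees. -/

section Parity

theorem koszulSign_congr_parity (ε : ℤˣ) {m n : ℕ} (c d : Fin m → ℕ) (e : Fin m ≃ Fin n)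
    (h : ∀ i, c i % 2 = d i % 2) : koszulSign ε c e = koszulSign ε d e := by
  unfold koszulSign
  refine Finset.prod_congr rfl fun i _ => Finset.prod_congr rfl fun j _ => ?_
  rw [Int.units_pow_eq_pow_mod_two ε (c i * c j), Int.units_pow_eq_pow_mod_two ε (d i * d j),
    Nat.mul_mod, h, h, ← Nat.mul_mod]

/-- An inversion contributes a sign only if both of its degrees are odd. The hypothesis covers the
case of all degrees even and that of a single odd one. -/
theorem koszulSign_eq_one (ε : ℤˣ) {m n : ℕ} (d : Fin m → ℕ) (e : Fin m ≃ Fin n)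
    (h : ∀ i j, i ≠ j → Even (d i * d j)) : koszulSign ε d e = 1 := by
  unfold koszulSign
  refine Finset.prod_eq_one fun i _ => Finset.prod_eq_one fun j _ => ?_
  split_ifs with hij
  · obtain ⟨k, hk⟩ := h i j hij.1.ne
    rw [hk, ← two_mul, pow_mul, Int.units_sq, one_pow]
  · rfl

theorem koszulSign_one {m n : ℕ} (d : Fin m → ℕ) (e : Fin m ≃ Fin n) : koszulSign 1 d e = 1 := by
  simp [koszulSign]

/-- The two positions are adjacent, so they form the only inversion and no other entry is crossed.
-/
theorem koszulSign_swap (ε : ℤˣ) {m : ℕ} (d : Fin m → ℕ) (a b : Fin m) (ha : (a : ℕ) = 0)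
    (hb : (b : ℕ) = 1) : koszulSign ε d (Equiv.swap a b) = ε ^ (d a * d b) := by
  have h : ∀ i j, (i < j ∧ Equiv.swap a b j < Equiv.swap a b i) ↔ i = a ∧ j = b := by
    intro i j
    simp only [Equiv.swap_apply_def]
    split_ifs <;> simp only [Fin.lt_def, Fin.ext_iff] at * <;> omega
  unfold koszulSign
  simp only [h]
  rw [Finset.prod_eq_single a, Finset.prod_eq_single b] <;> simp +contextual

variable {F : Type w} [Field F] {ε : ℤˣ} {P : Operad.{w, u} F}

/-- The subspace spanned by the homogeneous elements whose degree has the parity of `c`. -/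
def GradedSpace.parity (V : GradedSpace.{w, v} F) (c : ℕ) : Submodule F V.carrier :=
  Submodule.span F {x | ∃ d, d % 2 = c % 2 ∧ x ∈ V.deg d}

/-- The odd part is the first summand, which is the form required by `PAlgebra.pow_odd_add_even`. -/
theorem GradedSpace.exists_add_parity (V : GradedSpace.{w, v} F) (x : V.carrier) :
    ∃ y ∈ V.parity 0, ∃ z ∈ V.parity 1, z + y = x := by
  have h : V.parity 1 ⊔ V.parity 0 = ⊤ := by
    rw [eq_top_iff, ← V.span_homogeneous, Submodule.span_le]
    rintro x ⟨d, hx⟩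
    rcases Nat.mod_two_eq_zero_or_one d with hd | hd
    · exact Submodule.mem_sup_right (Submodule.subset_span ⟨d, hd, hx⟩)
    · exact Submodule.mem_sup_left (Submodule.subset_span ⟨d, hd, hx⟩)
  obtain ⟨z, hz, y, hy, hx⟩ := Submodule.mem_sup.1 (h ▸ Submodule.mem_top : x ∈ _)
  exact ⟨y, hy, z, hz, hx⟩

/-- Koszul signs depend only on parities, so the symmetry axiom extends from homogeneous elements to
sums of homogeneous elements of equal parity. This allows additivity to be proved by splitting an
arbitrary element into just two parts. -/
theorem PAlgebra.op_act_parity (A : PAlgebra.{w, u, v} ε P) {m n : ℕ} (e : Fin m ≃ Fin n)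
    (μ : P.Op n) (c : Fin m → ℕ) (x : Fin m → A.carrier) (hx : ∀ i, x i ∈ A.parity (c i)) :
    A.op (P.act e μ) x = koszulSign ε c e • A.op μ (x ∘ e.symm) := by
  have : (A.op (P.act e μ) - ((koszulSign ε c e : ℤˣ) : ℤ) • (A.op μ).domDomCongr e.symm) x =
      0 := by
    refine multilinear_eq_zero _ (fun i => {x | ∃ d, d % 2 = c i % 2 ∧ x ∈ A.deg d}) ?_ x hx
    intro y hy
    choose d hd hy using hy
    rw [sub_apply, smul_apply, MultilinearMap.domDomCongr_apply, A.op_act e μ d y hy,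
      koszulSign_congr_parity ε d c e hd, sub_eq_zero]
    rfl
  rw [sub_apply, smul_apply, MultilinearMap.domDomCongr_apply, sub_eq_zero] at this
  exact this

end Parity

/-! ### Transitivity of the symmetric group on subsets of given size and on ordered pairs. -/

theorem exists_perm_of_card_eq {p : ℕ} {s t : Finset (Fin p)} (h : s.card = t.card) :
    ∃ σ : Equiv.Perm (Fin p), ∀ i, σ i ∈ t ↔ i ∈ s := by
  have e : {i // i ∈ s} ≃ {i // i ∈ t} := Fintype.equivOfCardEq (by simpa using h)
  refine ⟨e.extendSubtype, fun i => ⟨fun hi => ?_, fun hi => e.extendSubtype_mem i hi⟩⟩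
  by_contra hs
  exact e.extendSubtype_not_mem i hs hi

theorem exists_perm_apply_eq {α : Type*} [DecidableEq α] {i j a b : α} (hij : i ≠ j)
    (hab : a ≠ b) : ∃ σ : Equiv.Perm α, σ i = a ∧ σ j = b := by
  -- After `i` has been moved to `a`, the image of `j` differs from `a`; so the second
  -- transposition, which takes this image to `b`, fixes `a`.
  have h : Equiv.swap i a j ≠ a := fun h =>
    hij ((Equiv.swap i a).injective (by rw [h, Equiv.swap_apply_left]))
  exact ⟨(Equiv.swap i a).trans (Equiv.swap (Equiv.swap i a j) b), by
    simp [Equiv.swap_apply_of_ne_of_ne h.symm hab], by simp⟩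

/-! ### The map `x ↦ star (x, ..., x)` is linear and commutes with the operations. -/

section Power

variable {p : ℕ} [Fact p.Prime] {ε : ℤˣ} {P : Operad.{0, u} (ZMod p)}

theorem units_smul_eq_self_of_two {W : Type*} [AddCommGroup W] [Module (ZMod p) W] (hp : p = 2)
    (c : ℤˣ) (z : W) : c • z = z := by
  subst hp
  rcases Int.units_eq_one_or c with rfl | rfl
  · simp
  · have : (2 : ZMod 2) • z = 0 := by
      rw [show (2 : ZMod 2) = 0 from rfl, zero_smul]
    rw [two_smul] at this
    rw [Units.neg_smul, one_smul, neg_eq_iff_add_eq_zero, this]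

variable (A : PAlgebra.{0, u, v} ε P) {star : P.Op p}

theorem PAlgebra.op_symmetric (hsymm : P.IsSymmetric star)
    (σ : Equiv.Perm (Fin p)) (c : Fin p → ℕ) (x : Fin p → A.carrier)
    (hx : ∀ i, x i ∈ A.parity (c i)) :
    A.op star x = koszulSign ε c σ • A.op star (x ∘ σ.symm) := by
  rw [← A.op_act_parity σ star c x hx, hsymm σ]

/-- A permutation that carries `s` to `t` carries one tuple of inputs to the other. Signless
invariance is assumed only for the tuple given by `s`; this is what remains available in the
presence of Koszul signs. -/
theorem PAlgebra.op_symmetric_of_card {x y : A.carrier} (s t : Finset (Fin p))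
    (hst : s.card = t.card)
    (h : ∀ σ : Equiv.Perm (Fin p), A.op star (s.piecewise (fun _ => x) fun _ => y) =
      A.op star (s.piecewise (fun _ => x) (fun _ => y) ∘ σ.symm)) :
    A.op star (s.piecewise (fun _ => x) fun _ => y) =
      A.op star (t.piecewise (fun _ => x) fun _ => y) := by
  obtain ⟨σ, hσ⟩ := exists_perm_of_card_eq hst
  rw [h σ]
  congr 1
  funext i
  have := hσ (σ.symm i)
  rw [Equiv.apply_symm_apply] at this
  simp only [Function.comp_apply, Finset.piecewise, this]

/-- All signs are trivial for `ε = 1`, and they act trivially for `p = 2` since `-1 = 1`. Invariance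
then passes from homogeneous inputs to all inputs by multilinearity. -/
theorem PAlgebra.op_symmetric_of_signless (hsymm : P.IsSymmetric star)
    (h : ε = 1 ∨ p = 2) (σ : Equiv.Perm (Fin p))
    (x : Fin p → A.carrier) : A.op star x = A.op star (x ∘ σ.symm) := by
  have : A.op star = (A.op star).domDomCongr σ.symm := by
    refine multilinear_ext _ _ _ (fun _ => A.span_homogeneous) fun x hx => ?_
    choose d hx using hx
    have h1 := A.op_act σ star d x hx
    rw [hsymm σ] at h1
    rw [h1]
    rcases h with rfl | h
    · rw [koszulSign_one, one_smul]; rfl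
    · rw [units_smul_eq_self_of_two h]; rfl
  exact congrArg (fun f => f x) this

/-- Exchanging two equal odd inputs leaves the tuple unchanged but introduces the sign `-1`; hence
twice the value is zero, and `2` is invertible. The two inputs are first moved to the positions `0`
and `1`, where the sign of the exchange is a single factor. -/
theorem PAlgebra.op_eq_zero_of_odd (hsymm : P.IsSymmetric star)
    (hε : ε = -1) (hp : p ≠ 2) (c : Fin p → ℕ)
    (x : Fin p → A.carrier) (hx : ∀ i, x i ∈ A.parity (c i)) (i j : Fin p) (hij : i ≠ j)
    (hxij : x i = x j) (hi : c i = 1) (hj : c j = 1) : A.op star x = 0 := by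
  have hp2 : 2 ≤ p := (Fact.out : p.Prime).two_le
  let a : Fin p := ⟨0, by omega⟩
  let b : Fin p := ⟨1, by omega⟩
  have hab : a ≠ b := by simp [a, b]
  obtain ⟨σ, ha, hb⟩ := exists_perm_apply_eq hij hab
  rw [A.op_symmetric hsymm σ c x hx]
  have h1 := A.op_symmetric hsymm (Equiv.swap a b) (c ∘ σ.symm) (x ∘ σ.symm) fun i => hx _
  have ha' : σ.symm a = i := by rw [← ha, Equiv.symm_apply_apply]
  have hb' : σ.symm b = j := by rw [← hb, Equiv.symm_apply_apply]
  have h2 : (x ∘ σ.symm) ∘ (Equiv.swap a b).symm = x ∘ σ.symm := by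
    funext k
    simp only [Function.comp_apply, Equiv.symm_swap]
    rw [Equiv.swap_apply_def]
    split_ifs with h h
    · rw [h, ha', hb', hxij]
    · rw [h, ha', hb', hxij]
    · rfl
  -- The value `-1` is substituted for `ε` in this one scalar only, because the type of `A` also
  -- depends on `ε`.
  rw [h2, koszulSign_swap _ _ _ _ rfl rfl, Function.comp_apply, Function.comp_apply, ha', hb',
    hi, hj, mul_one, pow_one, show ε • A.op star (x ∘ σ.symm) = (-1 : ℤˣ) • A.op star (x ∘ σ.symm)
      from congrArg (fun c : ℤˣ => c • A.op star (x ∘ σ.symm)) hε, Units.neg_smul, one_smul,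
    eq_neg_iff_add_eq_zero, ← two_smul (ZMod p), smul_eq_zero] at h1
  rcases h1 with h1 | h1
  · have : p ∣ 2 := (ZMod.natCast_eq_zero_iff 2 p).1 (by exact_mod_cast h1)
    exact (hp ((Nat.prime_dvd_prime_iff_eq Fact.out Nat.prime_two).1 this)).elim
  · rw [h1, smul_zero]

theorem PAlgebra.pow_eq_zero_of_odd (hsymm : P.IsSymmetric star)
    (hε : ε = -1) (hp : p ≠ 2) (x : A.carrier)
    (hx : x ∈ A.parity 1) : A.op star (fun _ => x) = 0 := by
  have hp2 : 2 ≤ p := (Fact.out : p.Prime).two_le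
  exact A.op_eq_zero_of_odd hsymm hε hp (fun _ => 1) _ (fun _ => hx) ⟨0, by omega⟩ ⟨1, by omega⟩
    (by simp) rfl rfl rfl

theorem PAlgebra.pow_add_of_even (hsymm : P.IsSymmetric star)
    {x y : A.carrier} (hx : x ∈ A.parity 0) (hy : y ∈ A.parity 0) :
    A.op star (fun _ => x + y) = A.op star (fun _ => x) + A.op star (fun _ => y) := by
  refine add_pow_of_card _ _ _ fun s t hst => A.op_symmetric_of_card s t hst fun σ => ?_
  rw [A.op_symmetric hsymm σ (fun _ => 0), koszulSign_eq_one _ _ _ (by simp), one_smul]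
  intro i
  by_cases hi : i ∈ s <;> simp [hi, hx, hy]

/-- In the expansion, a term with at least two inputs `x` vanishes, and a term with at most one odd
input is permuted without sign. Either way it depends only on the number of inputs `x`, so the power
is additive here, and the power of `x` is zero. -/
theorem PAlgebra.pow_odd_add_even (hsymm : P.IsSymmetric star)
    (hε : ε = -1) (hp : p ≠ 2) {x y : A.carrier}
    (hx : x ∈ A.parity 1) (hy : y ∈ A.parity 0) :
    A.op star (fun _ => x + y) = A.op star (fun _ => y) := by
  have key : A.op star (fun _ => x + y) = A.op star (fun _ => x) + A.op star (fun _ => y) := by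
    refine add_pow_of_card _ _ _ fun s t hst => ?_
    have hs : ∀ s : Finset (Fin p), ∀ i, s.piecewise (fun _ => x) (fun _ => y) i ∈
        A.parity (if i ∈ s then 1 else 0) := by
      intro s i
      by_cases hi : i ∈ s <;> simp [hi, hx, hy]
    by_cases h1 : 1 < s.card
    · have h0 : ∀ s : Finset (Fin p), 1 < s.card →
          A.op star (s.piecewise (fun _ => x) fun _ => y) = 0 := by
        intro s h1
        obtain ⟨i, hi, j, hj, hij⟩ := Finset.one_lt_card.1 h1
        exact A.op_eq_zero_of_odd hsymm hε hp _ _ (hs s) i j hij (by simp [hi, hj]) (by simp [hi])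
          (by simp [hj])
      rw [h0 s h1, h0 t (hst ▸ h1)]
    · refine A.op_symmetric_of_card s t hst fun σ => ?_
      rw [A.op_symmetric hsymm σ _ _ (hs s), koszulSign_eq_one, one_smul]
      intro i j hij
      by_cases hi : i ∈ s
      · by_cases hj : j ∈ s
        · exact (h1 (Finset.one_lt_card.2 ⟨i, hi, j, hj, hij⟩)).elim
        · simp [hj]
      · simp [hi]
  rw [key, A.pow_eq_zero_of_odd hsymm hε hp x hx, zero_add]

theorem PAlgebra.pow_add (hsymm : P.IsSymmetric star) (x y : A.carrier) :
    A.op star (fun _ => x + y) = A.op star (fun _ => x) + A.op star (fun _ => y) := by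
  by_cases h : ε = 1 ∨ p = 2
  · exact add_pow_of_card _ _ _ fun s t hst => A.op_symmetric_of_card s t hst fun σ =>
      A.op_symmetric_of_signless hsymm h σ _
  · rw [not_or] at h
    have hε : ε = -1 := (Int.units_eq_one_or ε).resolve_left h.1
    obtain ⟨x0, hx0, x1, hx1, rfl⟩ := A.exists_add_parity x
    obtain ⟨y0, hy0, y1, hy1, rfl⟩ := A.exists_add_parity y
    -- The odd parts of `x`, `y` and `x + y` all drop out, which reduces the claim to the even
    -- parts.
    rw [A.pow_odd_add_even hsymm hε h.2 hx1 hx0, A.pow_odd_add_even hsymm hε h.2 hy1 hy0,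
      add_add_add_comm, A.pow_odd_add_even hsymm hε h.2 (add_mem hx1 hy1) (add_mem hx0 hy0),
      A.pow_add_of_even hsymm hx0 hy0]

/-- The linear map `x ↦ star (x, ..., x)`. -/
noncomputable def PAlgebra.powMap (hsymm : P.IsSymmetric star) :
    A.carrier →ₗ[ZMod p] A.carrier where
  toFun x := A.op star fun _ => x
  map_add' := A.pow_add hsymm
  map_smul' c x := by
    -- The scalar that comes out is `c ^ p`, which is `c` in `𝔽_p`.
    rw [MultilinearMap.map_smul_univ (A.op star) (fun _ => c) (fun _ => x)]
    simp

theorem PAlgebra.powMap_apply (hsymm : P.IsSymmetric star) (x : A.carrier) :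
    A.powMap hsymm x = A.op star fun _ => x := rfl

theorem PAlgebra.powMap_deg (hsymm : P.IsSymmetric star) (d : ℕ) (x : A.carrier)
    (hx : x ∈ A.deg d) : A.powMap hsymm x ∈ A.deg (p * d) := by
  have := A.op_deg star (fun _ => d) (fun _ => x) fun _ => hx
  rwa [Finset.sum_const, Finset.card_univ, Fintype.card_fin, smul_eq_mul] at this

/-- A `p × n` array whose rows all equal `v` has constant columns. -/
theorem flatten_comp_blockTranspose_symm {α : Type*} {p n : ℕ} (v : Fin n → α) :
    flatten (fun (_ : Fin p) => v) ∘ (blockTranspose p n).symm =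
      flatten fun i (_ : Fin p) => v i := by
  rw [← Function.Surjective.right_cancellable (blockTranspose p n).surjective]
  funext a
  revert a
  rw [forall_flat]
  intro i j
  have : blockTranspose p n (finSigmaFinEquiv ⟨i, j⟩) = finSigmaFinEquiv ⟨j, i⟩ := by
    simp [blockTranspose]
  simp only [Function.comp_apply, Equiv.symm_apply_apply]
  rw [this, flatten_apply, flatten_apply]

/-- Centrality gives the identity up to the Koszul sign of the block transposition. If signs act
nontrivially, then either all degrees are even and the sign is `1`, or some `x i` is odd, its
`star`-power is zero and both sides vanish. -/
theorem PAlgebra.powMap_op (hsymm : P.IsSymmetric star) (hcentral : P.IsCentral star)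
    {n : ℕ} (μ : P.Op n) (d : Fin n → ℕ)
    (x : Fin n → A.carrier) (hx : ∀ i, x i ∈ A.deg (d i)) :
    A.powMap hsymm (A.op μ x) = A.op μ fun i => A.powMap hsymm (x i) := by
  have h1 : A.powMap hsymm (A.op μ x) =
      koszulSign ε (flatten fun (_ : Fin p) => d) (blockTranspose p n) •
        A.op μ fun i => A.powMap hsymm (x i) := by
    rw [A.powMap_apply, ← A.op_comp (fun _ => n) star (fun _ => μ) fun _ => x, hcentral n μ,
      A.op_act (blockTranspose p n) _ (flatten fun (_ : Fin p) => d),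
      flatten_comp_blockTranspose_symm, A.op_comp]
    · rfl
    · rw [forall_flat]
      intro i j
      rw [flatten_apply, flatten_apply]
      exact hx j
  rw [h1]
  by_cases h : ε = 1 ∨ p = 2
  · rcases h with rfl | h
    · rw [koszulSign_one, one_smul]
    · rw [units_smul_eq_self_of_two h]
  · rw [not_or] at h
    have hε : ε = -1 := (Int.units_eq_one_or ε).resolve_left h.1
    by_cases hd : ∀ i, Even (d i)
    · rw [koszulSign_eq_one, one_smul]
      intro i j _
      exact (hd _).mul_right _
    · obtain ⟨i, hi⟩ := not_forall.1 hd
      have h0 : A.powMap hsymm (x i) = 0 := A.pow_eq_zero_of_odd hsymm hε h.2 _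
        (Submodule.subset_span ⟨d i, Nat.odd_iff.1 (Nat.not_even_iff_odd.1 hi), hx i⟩)
      rw [(A.op μ).map_coord_zero i h0, smul_zero]

end Power

/-! ### Morphisms of graded `P`-algebras. -/

section Hom

variable {F : Type w} [Field F] {ε : ℤˣ} {P : Operad.{w, u} F}

/-- Morphisms of graded `P`-algebras. -/
structure PAlgebra.IsHom (A : PAlgebra.{w, u, v} ε P) (B : PAlgebra.{w, u, v'} ε P)
    (f : A.carrier →ₗ[F] B.carrier) : Prop where
  map_deg : ∀ d x, x ∈ A.deg d → f x ∈ B.deg d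
  map_op : ∀ {n : ℕ} (μ : P.Op n) (x : Fin n → A.carrier),
    f (A.op μ x) = B.op μ fun i => f (x i)

variable {A : PAlgebra.{w, u, v} ε P} {B : PAlgebra.{w, u, v'} ε P}

/-- The isomorphism of graded `P`-algebras given by a morphism and its inverse. -/
def PAlgebra.IsHom.toIso {f : A.carrier →ₗ[F] B.carrier} {g : B.carrier →ₗ[F] A.carrier}
    (hf : A.IsHom B f) (hg : B.IsHom A g) (hgf : g ∘ₗ f = LinearMap.id)
    (hfg : f ∘ₗ g = LinearMap.id) : A.Iso B where
  toLinearEquiv := LinearEquiv.ofLinearMap f g hfg hgf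
  map_deg d x := by
    refine ⟨fun h => ?_, hf.map_deg d x⟩
    have h1 : g (f x) ∈ A.deg d := hg.map_deg d _ h
    rwa [← LinearMap.comp_apply, hgf] at h1
  map_op := hf.map_op

theorem PAlgebra.IsHom.comp {C : PAlgebra ε P} {f : A.carrier →ₗ[F] B.carrier}
    {g : B.carrier →ₗ[F] C.carrier} (hg : B.IsHom C g) (hf : A.IsHom B f) :
    A.IsHom C (g ∘ₗ f) where
  map_deg d x hx := hg.map_deg d _ (hf.map_deg d x hx)
  map_op μ x := by simp only [LinearMap.comp_apply, hf.map_op, hg.map_op]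

theorem PAlgebra.isHom_id : A.IsHom A LinearMap.id where
  map_deg _ _ hx := hx
  map_op _ _ := rfl

theorem PAlgebra.IsHom.isIdeal_ker {f : A.carrier →ₗ[F] B.carrier} (hf : A.IsHom B f) :
    A.IsIdeal (LinearMap.ker f) where
  homogeneous d x hx := by
    have h : f ∘ₗ A.proj d = B.proj d ∘ₗ f := by
      refine LinearMap.ext_on A.span_homogeneous ?_
      rintro x ⟨i, hx⟩
      rw [LinearMap.comp_apply, LinearMap.comp_apply, A.proj_of_mem d hx,
        B.proj_of_mem d (hf.map_deg i x hx)]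
      split_ifs <;> simp
    rw [LinearMap.mem_ker] at hx ⊢
    rw [← LinearMap.comp_apply, h, LinearMap.comp_apply, hx, map_zero]
  op_mem μ x i hx := by
    rw [LinearMap.mem_ker] at hx ⊢
    rw [hf.map_op]
    exact (B.op μ).map_coord_zero i hx

variable (ε P) (V : GradedSpace.{w, v} F)

/-- The inclusion of the generators in the free algebra `S(P, V)`. -/
noncomputable def freeInc : V.carrier →ₗ[F] (freeAlgebra ε P V).carrier := freeGen ε P V

variable {ε P V}

theorem freeInc_deg (d : ℕ) (x : V.carrier) (hx : x ∈ V.deg d) :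
    freeInc ε P V x ∈ (freeAlgebra ε P V).deg d := freeGen_deg d x hx

theorem exists_freeAlgebra_hom (A : PAlgebra.{w, u, v'} ε P) (g : V.carrier →ₗ[F] A.carrier)
    (hg : ∀ d x, x ∈ V.deg d → g x ∈ A.deg d) :
    ∃ f : (freeAlgebra ε P V).carrier →ₗ[F] A.carrier,
      (freeAlgebra ε P V).IsHom A f ∧ ∀ x, f (freeInc ε P V x) = g x :=
  ⟨freeLift A g hg, ⟨freeLift_deg A g hg, freeLift_op A g hg⟩, freeLift_freeGen A g hg⟩

/-- This concerns arbitrary linear maps, since it is applied to composites with Frobenius maps,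
which multiply degrees by `p` and so are not morphisms. Homogeneous generators suffice, as
`PAlgebra.powMap_op` requires. -/
theorem freeAlgebra_ext {W : Type*} [AddCommGroup W] [Module F W]
    {f g : (freeAlgebra ε P V).carrier →ₗ[F] W}
    (h : ∀ {n : ℕ} (μ : P.Op n) (d : Fin n → ℕ) (x : Fin n → V.carrier),
      (∀ i, x i ∈ V.deg (d i)) → f ((freeAlgebra ε P V).op μ fun i => freeInc ε P V (x i)) =
        g ((freeAlgebra ε P V).op μ fun i => freeInc ε P V (x i))) : f = g := by
  refine schur_hom_ext fun n m => ?_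
  have := h m.coeff m.degs m.vec m.vec_mem
  have h1 : (freeAlgebra ε P V).op m.coeff (fun i => freeInc ε P V (m.vec i)) =
    mon m.coeff m.vec := opS_freeGen _ _
  rw [h1] at this
  exact this

theorem freeAlgebra_hom_ext {A : PAlgebra.{w, u, v'} ε P}
    {f g : (freeAlgebra ε P V).carrier →ₗ[F] A.carrier} (hf : (freeAlgebra ε P V).IsHom A f)
    (hg : (freeAlgebra ε P V).IsHom A g)
    (h : ∀ x, f (freeInc ε P V x) = g (freeInc ε P V x)) : f = g :=
  freeAlgebra_ext fun μ _ x _ => by simp only [hf.map_op, hg.map_op, h]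

end Hom

section FreeAdapted

variable {p : ℕ} [Fact p.Prime] {ε : ℤˣ} {P : Operad.{0, u} (ZMod p)} {star : P.Op p}

theorem PAlgebra.IsHom.map_powMap {A : PAlgebra.{0, u, v} ε P} {B : PAlgebra.{0, u, v'} ε P}
    {f : A.carrier →ₗ[ZMod p] B.carrier} (hf : A.IsHom B f) (hsymm : P.IsSymmetric star)
    (x : A.carrier) : f (A.powMap hsymm x) = B.powMap hsymm (f x) := hf.map_op star _

/-! ### The universal property of the free algebra with adapted Frobenius. -/

section Quotient

variable (ε P star) (M : FrobSpace.{v} p)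

/-- The Frobenius map of the free algebra on a graded vector space with Frobenius map. -/
noncomputable def freeAlgebraFrob : (freeAlgebra ε P M.toGradedSpace).carrier →ₗ[ZMod p]
    (freeAlgebra ε P M.toGradedSpace).carrier := schurFrob ε P M

/-- The projection of `S(P, M)` onto its quotient with `star`-adapted Frobenius. -/
noncomputable def adaptedMk : (freeAlgebra ε P M.toGradedSpace).carrier →ₗ[ZMod p]
    (freeAdapted ε P star M).carrier :=
  ((freeFrobAlgebra ε P M).idealSpan ((freeFrobAlgebra ε P M).adaptedRel star)).mkQ

/-- The inclusion of the generators in the free algebra with `star`-adapted Frobenius. -/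
noncomputable def adaptedInc : M.carrier →ₗ[ZMod p] (freeAdapted ε P star M).carrier :=
  adaptedMk ε P star M ∘ₗ freeInc ε P M.toGradedSpace

variable {ε P star M}

theorem freeAlgebraFrob_op {n : ℕ} (μ : P.Op n)
    (x : Fin n → (freeAlgebra ε P M.toGradedSpace).carrier) :
    freeAlgebraFrob ε P M ((freeAlgebra ε P M.toGradedSpace).op μ x) =
      (freeAlgebra ε P M.toGradedSpace).op μ fun i => freeAlgebraFrob ε P M (x i) :=
  schurFrob_opS ε P M μ x

theorem freeAlgebraFrob_freeInc (x : M.carrier) :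
    freeAlgebraFrob ε P M (freeInc ε P M.toGradedSpace x) =
      freeInc ε P M.toGradedSpace (M.frob x) := schurFrob_mon ε P M _ _

theorem adaptedMk_surjective : Function.Surjective (adaptedMk ε P star M) :=
  Submodule.mkQ_surjective
    ((freeFrobAlgebra ε P M).idealSpan ((freeFrobAlgebra ε P M).adaptedRel star))

theorem adaptedMk_isHom : (freeAlgebra ε P M.toGradedSpace).IsHom
    (freeAdapted ε P star M).toPAlgebra (adaptedMk ε P star M) where
  map_deg _ x hx := ⟨x, hx, rfl⟩
  map_op μ x := (((freeFrobAlgebra ε P M).isIdeal_idealSpan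
    ((freeFrobAlgebra ε P M).adaptedRel star)).op_mkQ μ x).symm

theorem adaptedInc_deg (d : ℕ) (x : M.carrier) (hx : x ∈ M.deg d) :
    adaptedInc ε P star M x ∈ (freeAdapted ε P star M).deg d :=
  adaptedMk_isHom.map_deg d _ (freeInc_deg d x hx)

theorem adaptedMk_frob (hsymm : P.IsSymmetric star)
    (x : (freeAlgebra ε P M.toGradedSpace).carrier) :
    adaptedMk ε P star M (freeAlgebraFrob ε P M x) =
      (freeAdapted ε P star M).toPAlgebra.powMap hsymm (adaptedMk ε P star M x) :=
  freeAdapted_isAdapted star M (adaptedMk ε P star M x)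

theorem adaptedInc_frob (hsymm : P.IsSymmetric star) (x : M.carrier) :
    adaptedInc ε P star M (M.frob x) =
      (freeAdapted ε P star M).toPAlgebra.powMap hsymm (adaptedInc ε P star M x) := by
  rw [adaptedInc, LinearMap.comp_apply, LinearMap.comp_apply, ← adaptedMk_frob,
    freeAlgebraFrob_freeInc]

theorem freeAdapted_hom_ext {A : PAlgebra.{0, u, v'} ε P}
    {f g : (freeAdapted ε P star M).carrier →ₗ[ZMod p] A.carrier}
    (hf : (freeAdapted ε P star M).IsHom A f) (hg : (freeAdapted ε P star M).IsHom A g)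
    (h : ∀ x, f (adaptedInc ε P star M x) = g (adaptedInc ε P star M x)) : f = g := by
  have := freeAlgebra_hom_ext (hf.comp adaptedMk_isHom) (hg.comp adaptedMk_isHom) h
  refine LinearMap.ext fun x => ?_
  obtain ⟨y, rfl⟩ := adaptedMk_surjective x
  exact congrArg (fun f => f y) this

/-- Both composites are linear and are compatible with the operations on homogeneous generators, the
`star`-power by centrality. So compatibility on `M` spreads to all of `S(P, M)`. -/
theorem map_freeAlgebraFrob {A : PAlgebra.{0, u, v'} ε P} (hsymm : P.IsSymmetric star)
    (hcentral : P.IsCentral star)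
    {f : (freeAlgebra ε P M.toGradedSpace).carrier →ₗ[ZMod p] A.carrier}
    (hf : (freeAlgebra ε P M.toGradedSpace).IsHom A f)
    (h : ∀ x, f (freeInc ε P M.toGradedSpace (M.frob x)) =
      A.powMap hsymm (f (freeInc ε P M.toGradedSpace x)))
    (x : (freeAlgebra ε P M.toGradedSpace).carrier) :
    f (freeAlgebraFrob ε P M x) = A.powMap hsymm (f x) := by
  have : f ∘ₗ freeAlgebraFrob ε P M = A.powMap hsymm ∘ₗ f := by
    refine freeAlgebra_ext fun μ d x hx => ?_
    rw [LinearMap.comp_apply, LinearMap.comp_apply, freeAlgebraFrob_op, hf.map_op, hf.map_op,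
      A.powMap_op hsymm hcentral μ d _ fun i => hf.map_deg _ _ (freeInc_deg _ _ (hx i))]
    simp only [freeAlgebraFrob_freeInc, h]
  exact congrArg (fun f => f x) this

/-- The target carries no Frobenius map of its own, its `star`-power being one. The extension of `g`
to `S(P, M)` intertwines the Frobenius with this power, so it kills the defining relations, and its
kernel is an ideal. -/
theorem exists_freeAdapted_hom (A : PAlgebra.{0, u, v'} ε P) (hsymm : P.IsSymmetric star)
    (hcentral : P.IsCentral star) (g : M.carrier →ₗ[ZMod p] A.carrier)
    (hg : ∀ d x, x ∈ M.deg d → g x ∈ A.deg d)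
    (hfrob : ∀ x, g (M.frob x) = A.powMap hsymm (g x)) :
    ∃ f : (freeAdapted ε P star M).carrier →ₗ[ZMod p] A.carrier,
      (freeAdapted ε P star M).IsHom A f ∧ ∀ x, f (adaptedInc ε P star M x) = g x := by
  obtain ⟨f, hf, hfg⟩ := exists_freeAlgebra_hom A g hg
  have hff := map_freeAlgebraFrob hsymm hcentral hf (by simpa only [hfg] using hfrob)
  have hker : (freeFrobAlgebra ε P M).idealSpan ((freeFrobAlgebra ε P M).adaptedRel star) ≤
      LinearMap.ker f := by
    refine PAlgebra.idealSpan_le _ hf.isIdeal_ker ?_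
    rintro _ ⟨t, rfl⟩
    -- Both `t^[p]` and `star (t, ..., t)` are sent to the `star`-power of `f t`.
    exact (map_sub f _ _).trans
      (sub_eq_zero.2 ((hff t).trans (hf.map_op star fun _ => t).symm))
  refine ⟨Submodule.liftQ _ f hker, ⟨?_, ?_⟩, hfg⟩
  · rintro d _ ⟨x, hx, rfl⟩
    exact hf.map_deg d x hx
  · intro n μ x
    choose y hy using fun i => adaptedMk_surjective (x i)
    obtain rfl : (fun i => adaptedMk ε P star M (y i)) = x := funext hy
    exact (congrArg _ (adaptedMk_isHom.map_op μ y).symm).trans (hf.map_op μ y)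

end Quotient

/-! ### The universal property of `Fr(V)`. -/

section FreeFrob

variable (V : GradedSpace.{0, v} (ZMod p))

/-- The map `x ↦ x^[p^k]` from `V` to `Fr(V)`. -/
noncomputable def freeFrobInc (k : ℕ) : V.carrier →ₗ[ZMod p] (freeFrob V).carrier :=
  (Finsupp.lsingle k : V.carrier →ₗ[ZMod p] ℕ →₀ V.carrier)

variable {V}

theorem freeFrobInc_deg (d : ℕ) (x : V.carrier) (hx : x ∈ V.deg d) :
    freeFrobInc V 0 x ∈ (freeFrob V).deg d :=
  Submodule.subset_span (M := ℕ →₀ V.carrier) ⟨0, d, x, by simp, hx, rfl⟩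

theorem frob_freeFrobInc (k : ℕ) (x : V.carrier) :
    (freeFrob V).frob (freeFrobInc V k x) = freeFrobInc V (k + 1) x :=
  Finsupp.mapDomain_single

theorem freeFrob_hom_ext {W : Type*} [AddCommGroup W] [Module (ZMod p) W]
    {f g : (freeFrob V).carrier →ₗ[ZMod p] W}
    (h : ∀ k x, f (freeFrobInc V k x) = g (freeFrobInc V k x)) : f = g :=
  Finsupp.lhom_ext h

/-- The universal property of `Fr(V)`. -/
theorem exists_freeFrob_hom (W : FrobSpace.{v'} p) (g : V.carrier →ₗ[ZMod p] W.carrier)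
    (hg : ∀ d x, x ∈ V.deg d → g x ∈ W.deg d) :
    ∃ f : (freeFrob V).carrier →ₗ[ZMod p] W.carrier,
      (∀ d x, x ∈ (freeFrob V).deg d → f x ∈ W.deg d) ∧
      (∀ x, f ((freeFrob V).frob x) = W.frob (f x)) ∧ ∀ x, f (freeFrobInc V 0 x) = g x := by
  let f : (freeFrob V).carrier →ₗ[ZMod p] W.carrier :=
    (Finsupp.lsum (ZMod p) fun k => (W.frob ^ k) ∘ₗ g : (ℕ →₀ V.carrier) →ₗ[ZMod p] W.carrier)
  have h : ∀ k x, f (freeFrobInc V k x) = (W.frob ^ k) (g x) := fun k x =>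
    Finsupp.lsum_single (ZMod p) _ k x
  have hdeg : ∀ k d x, x ∈ V.deg d → (W.frob ^ k) (g x) ∈ W.deg (p ^ k * d) := by
    intro k d x hx
    induction k with
    | zero => simpa using hg d x hx
    | succ k ih =>
      rw [pow_succ' W.frob, Module.End.mul_apply, pow_succ', mul_assoc]
      exact W.frob_deg _ _ ih
  refine ⟨f, fun d => ?_, fun x => ?_, fun x => h 0 x⟩
  · suffices (freeFrob V).deg d ≤ (W.deg d).comap f from fun x hx => this hx
    refine Submodule.span_le.2 ?_
    rintro _ ⟨k, i, x, rfl, hx, rfl⟩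
    exact (congrArg (· ∈ W.deg (p ^ k * i)) (h k x)).mpr (hdeg k i x hx)
  · have : f ∘ₗ (freeFrob V).frob = W.frob ∘ₗ f := freeFrob_hom_ext fun k x => by
      rw [LinearMap.comp_apply, LinearMap.comp_apply, frob_freeFrobInc, h, h, pow_succ',
        Module.End.mul_apply]
    exact congrArg (fun f => f x) this

/-- Two maps on `Fr(V)` compatible with Frobenius maps agree if they agree on `V`. -/
theorem freeFrob_ext {W : Type*} [AddCommGroup W] [Module (ZMod p) W] (φ : W →ₗ[ZMod p] W)
    {f g : (freeFrob V).carrier →ₗ[ZMod p] W} (hf : ∀ x, f ((freeFrob V).frob x) = φ (f x))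
    (hg : ∀ x, g ((freeFrob V).frob x) = φ (g x))
    (h : ∀ x, f (freeFrobInc V 0 x) = g (freeFrobInc V 0 x)) : f = g := by
  refine freeFrob_hom_ext fun k x => ?_
  induction k with
  | zero => exact h x
  | succ k ih => rw [← frob_freeFrobInc, hf, hg, ih]

end FreeFrob

/-! ### The two mutually inverse morphisms. -/

/-- The graded vector space with Frobenius map `x ↦ star (x, ..., x)` underlying a `P`-algebra. -/
noncomputable def PAlgebra.powSpace (A : PAlgebra.{0, u, v} ε P) (hsymm : P.IsSymmetric star) :
    FrobSpace.{v} p where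
  toGradedSpace := A.toGradedSpace
  frob := A.powMap hsymm
  frob_deg := A.powMap_deg hsymm

/-- The free `P`-algebra with `star`-adapted Frobenius on `Fr(V)` is the free `P`-algebra on `V`. -/
theorem nonempty_iso_freeAdapted_freeFrob (hsymm : P.IsSymmetric star)
    (hcentral : P.IsCentral star) (V : GradedSpace.{0, v} (ZMod p)) :
    Nonempty (PAlgebra.Iso (freeAdapted ε P star (freeFrob V)).toPAlgebra (freeAlgebra ε P V)) := by
  -- The map `e` sends `x^[p^k]` to the `k`-fold iterated `star`-power of the generator `x`.
  obtain ⟨e, hedeg, hefrob, he⟩ := exists_freeFrob_hom ((freeAlgebra ε P V).powSpace hsymm)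
    (freeInc ε P V) freeInc_deg
  obtain ⟨f, hf, hfe⟩ := exists_freeAdapted_hom (M := freeFrob V) (freeAlgebra ε P V) hsymm
    hcentral e hedeg hefrob
  obtain ⟨g, hg, hgi⟩ := exists_freeAlgebra_hom (freeAdapted ε P star (freeFrob V)).toPAlgebra
    (adaptedInc ε P star (freeFrob V) ∘ₗ freeFrobInc V 0)
    fun d x hx => adaptedInc_deg d _ (freeFrobInc_deg d x hx)
  refine ⟨hf.toIso hg (freeAdapted_hom_ext (hg.comp hf) PAlgebra.isHom_id fun x => ?_)
    (freeAlgebra_hom_ext (hf.comp hg) PAlgebra.isHom_id fun x => ?_)⟩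
  -- Both maps turn the Frobenius of `Fr(V)` into the `star`-power: the composite because morphisms
  -- preserve `star`-powers, the inclusion because the quotient is adapted. So they need to be
  -- compared only on `V`.
  · have key : g ∘ₗ e = adaptedInc ε P star (freeFrob V) := by
      refine freeFrob_ext ((freeAdapted ε P star (freeFrob V)).toPAlgebra.powMap hsymm)
        (fun x => ?_) (adaptedInc_frob hsymm) fun x => ?_
      · exact (congrArg g (hefrob x)).trans (hg.map_powMap hsymm (e x))
      · exact (congrArg g (he x)).trans (hgi x)
    exact (congrArg g (hfe x)).trans (congrArg (fun f => f x) key)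
  · exact (congrArg f (hgi x)).trans ((hfe _).trans (he x))

end FreeAdapted

end OperadFrob

theorem theorem3 (p : ℕ) [Fact p.Prime] (ε : ℤˣ) (P : OperadFrob.Operad.{0, u} (ZMod p))
    (star : P.Op p) (hsymm : P.IsSymmetric star) (hcentral : P.IsCentral star)
    (V : OperadFrob.GradedSpace.{0, v} (ZMod p)) :
    Nonempty (OperadFrob.PAlgebra.Iso
      (OperadFrob.freeAdapted ε P star (OperadFrob.freeFrob V)).toPAlgebra
      (OperadFrob.freeAlgebra ε P V)) :=
  OperadFrob.nonempty_iso_freeAdapted_freeFrob hsymm hcentral V
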